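/- **Conventions.** Let $m\ge n$ be integers. All maps are smooth, $x_1,\dots,x_n$ are the coordinates of $\mathbb R^n$, and $C_i=\operatorname{diag}(0,\dots,1,\dots,0)$ with the $1$ in place $i$. For an open set $\mathcal O\subset\mathbb R^n$, a triple $(F,G,B)$ of maps on $\mathcal O$, where $F=(f_{ij})$ is $n\times n$ with zero diagonal, $G=(g_{ij})$ is $(m-n)\times n$, and $B=(b_{ij})$ is $O(n)$-valued, is a *solution of the $G_{m,n}$-system II* if $$\begin{cases}(f_{ij})_{x_i}+(f_{ji})_{x_j}+\sum_{k=1}^n f_{ki}f_{kj}+\sum_{k=1}^{m-n}g_{ki}g_{kj}=0,& i\ne j,\\ (f_{ij})_{x_k}=f_{ik}f_{kj},& i,j,k\text{ distinct},\\ (b_{ij})_{x_k}=f_{kj}b_{ik},& j\neq k,\\ (g_{ij})_{x_k}=f_{kj}g_{ik},& j\ne k.\end{cases}$$ For an immersion $X:\mathcal O\to\mathbb R^m$ write $I=\langle dX,dX\rangle$, and let $II$ be the normal-bundle-valued form with $\langle II(v,w),\xi\rangle=\langle d\xi(v),dX(w)\rangle$ for all normal fields $\xi$ (the negative of the normal component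 of the second derivative of $X$). A normal field $\xi$ is parallel if the normal component of $d\xi$ vanishes. The normal bundle is flat if its induced connection $\nabla^\perp\xi=(d\xi)^\perp$ has zero curvature, and non-degenerate if at every point the space of shape operators $A_\xi$, $\langle A_\xi v,w\rangle=\langle II(v,w),\xi\rangle$, has dimension $n$. An *$n$-tuple in $\mathbb R^m$ of type $O(n)$* on $\mathcal O$ is a tuple $(X_1,\dots,X_n)$ of immersions $\mathcal O\to\mathbb R^m$ with flat normal bundles, such that for each $x\in\mathcal O$ the normal planes of all $X_j$ at $x$ are parallel, there is an orthonormal frame $e_{n+1},\dots,e_m$ of normal fields that is parallel for every $X_j$, and, for some maps $B=(b_{ij}):\mathcal O\to O(n)$ and $G=(g_{ij}):\mathcal O\to\mathcal M_{(m-n)\times n}$, $$I_j=\sum_{i=1}^n b_{ji}^2\,dx_i^2,\qquad II_j=\sum_{i=1}^n\sum_{k=1}^{m-n} b_{ji}g_{ki}\,dx_i^2\,e_{n+k}\qquad(1\le j\le n).\tag{$*$}$$ (So $x_1,\dots,x_n$ are common line of curvature coordinates, spherical because $\sum_i b_{ji}^2=1$.) **Theorem.** Let $(F,G,B)$ be a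 solution of the $G_{m,n}$-system II on $\mathbb R^n$. (i) $\tau=\sum_{i=1}^n\begin{pmatrix}-FC_i+C_iF^t& C_iG^t\\ -GC_i&0\end{pmatrix}dx_i$ is a flat $o(m)$-valued connection 1-form, and there exists $A:\mathbb R^n\to O(m)$ with $A^{-1}dA=\tau$. (ii) For every such $A$, with $A_1$ denoting its first $n$ columns, $\sum_i A_1C_iB^t\,dx_i$ is exact: there exists $X:\mathbb R^n\to\mathcal M_{m\times n}$ with $dX=-\sum_{i=1}^n A_1C_iB^t\,dx_i$. (iii) Suppose all entries of $B$ are nowhere zero. Let $A$, $X$ be as in (i), (ii), let $X_j$ be the $j$-th column of $X$, and $e_i$ the $i$-th column of $A$. Then $(X_1,\dots,X_n)$ is an $n$-tuple in $\mathbb R^m$ of type $O(n)$. In fact $e_1,\dots,e_n$ span the tangent plane of each $X_j$ (so these tangent planes are parallel), $e_{n+1},\dots,e_m$ is a parallel normal frame of each $X_j$, and $$I_j=\sum_{i=1}^n b_{ji}^2\,dx_i^2,\qquad II_j=-\sum_{i=1}^n\sum_{k=1}^{m-n}g_{ki}b_{ji}\,dx_i^2\,e_{n+k}.$$ Moreover,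 for each $j$ the normal bundle of $X_j$ is non-degenerate if and only if $G(x)$ has rank $n$ for every $x\in\mathbb R^n$. **Converse.** Let $m>n$, let $\mathcal O\subset\mathbb R^n$ be open, and let $(X_1,\dots,X_n)$ be an $n$-tuple in $\mathbb R^m$ of type $O(n)$ on $\mathcal O$ with common parallel normal frame $e_{n+1},\dots,e_m$ and fundamental forms $(*)$. If all entries of $G$ are nowhere zero on $\mathcal O$, then all entries of $B$ are nowhere zero, and for every $l\in\{1,\dots,n\}$ (in particular $l=1$) the triple $(F,G,B)$ with $f_{ij}=(b_{lj})_{x_i}/b_{li}$ for $i\ne j$ and $f_{ii}=0$ is a solution of the $G_{m,n}$-system II on $\mathcal O$. -/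

import Mathlib

open scoped ContDiff Matrix InnerProductSpace

noncomputable section

namespace GSystem

/-- The parameter space `ℝⁿ`. -/
abbrev Dom (n : ℕ) : Type := EuclideanSpace ℝ (Fin n)

/-- The ambient Euclidean space `ℝᵐ` with `m = n + r`. The coordinates (and the columns of an
`m × m` matrix) are indexed by `Fin n ⊕ Fin r`: `Sum.inl i` stands for the index `i ≤ n`, and
`Sum.inr k` for the index `n + k`. -/
abbrev Amb (n r : ℕ) : Type := EuclideanSpace ℝ (Fin n ⊕ Fin r)

/-- The partial derivative `∂f/∂xᵢ` of a real function at `x`. -/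
def pd {n : ℕ} (i : Fin n) (f : Dom n → ℝ) (x : Dom n) : ℝ :=
  fderiv ℝ f x (EuclideanSpace.single i 1)

/-- The entrywise partial derivative of a matrix-valued map. -/
def matPd {n : ℕ} {ι κ : Type*} (i : Fin n) (M : Dom n → Matrix ι κ ℝ) (x : Dom n) :
    Matrix ι κ ℝ :=
  Matrix.of fun a b => pd i (fun y => M y a b) x

/-- A matrix-valued map is smooth on `O` if all of its entries are `C^∞` there. -/
def MatSmoothOn {n : ℕ} {ι κ : Type*} (O : Set (Dom n)) (M : Dom n → Matrix ι κ ℝ) : Prop :=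
  ∀ a b, ContDiffOn ℝ ∞ (fun y => M y a b) O

/-- The diagonal matrix unit `Cᵢ = diag(0, …, 1, …, 0)`. -/
def diagUnit {n : ℕ} (i : Fin n) : Matrix (Fin n) (Fin n) ℝ := Matrix.single i i 1

/-- `(F, G, B)` is a (smooth) solution on `O` of the `G_{m,n}`-system II, where `m = n + r`,
`F` takes values in the matrices with zero diagonal, and `B` in the orthogonal group. -/
structure IsSolutionII {n r : ℕ} (O : Set (Dom n)) (F : Dom n → Matrix (Fin n) (Fin n) ℝ)
    (G : Dom n → Matrix (Fin r) (Fin n) ℝ) (B : Dom n → Matrix (Fin n) (Fin n) ℝ) : Prop where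
  smooth_F : MatSmoothOn O F
  smooth_G : MatSmoothOn O G
  smooth_B : MatSmoothOn O B
  diag_F : ∀ x ∈ O, ∀ i, F x i i = 0
  orth_B : ∀ x ∈ O, B x ∈ Matrix.orthogonalGroup (Fin n) ℝ
  eq_gauss : ∀ x ∈ O, ∀ i j, i ≠ j →
    pd i (fun y => F y i j) x + pd j (fun y => F y j i) x
      + ∑ k, F x k i * F x k j + ∑ k, G x k i * G x k j = 0
  eq_F : ∀ x ∈ O, ∀ i j k, i ≠ j → j ≠ k → i ≠ k →
    pd k (fun y => F y i j) x = F x i k * F x k j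
  eq_B : ∀ x ∈ O, ∀ i j k, j ≠ k → pd k (fun y => B y i j) x = F x k j * B x i k
  eq_G : ∀ x ∈ O, ∀ (i : Fin r) (j k : Fin n), j ≠ k →
    pd k (fun y => G y i j) x = F x k j * G x i k

/-- The coefficient `τᵢ` of `dxᵢ` in the connection 1-form
`τ = ∑ᵢ (-F Cᵢ + Cᵢ Fᵗ, Cᵢ Gᵗ; -G Cᵢ, 0) dxᵢ`. -/
def tau {n r : ℕ} (F : Dom n → Matrix (Fin n) (Fin n) ℝ) (G : Dom n → Matrix (Fin r) (Fin n) ℝ)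
    (i : Fin n) (x : Dom n) : Matrix (Fin n ⊕ Fin r) (Fin n ⊕ Fin r) ℝ :=
  Matrix.fromBlocks (-(F x * diagUnit i) + diagUnit i * (F x)ᵀ) (diagUnit i * (G x)ᵀ)
    (-(G x * diagUnit i)) 0

/-- The matrix-valued 1-form `∑ᵢ θᵢ dxᵢ` is a flat `o(m)`-valued connection on `ℝⁿ`: it is smooth,
skew-symmetric, and `∂ᵢ θⱼ - ∂ⱼ θᵢ + [θᵢ, θⱼ] = 0`. -/
def IsFlatConnection {n : ℕ} {ι : Type*} [Fintype ι]
    (θ : Fin n → Dom n → Matrix ι ι ℝ) : Prop :=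
  (∀ i, MatSmoothOn Set.univ (θ i)) ∧ (∀ i x, (θ i x)ᵀ = -θ i x) ∧
    ∀ i j x, matPd i (θ j) x - matPd j (θ i) x + (θ i x * θ j x - θ j x * θ i x) = 0

/-- `A : ℝⁿ → O(m)` is smooth and `A⁻¹ dA = τ`. -/
def IsFrameII {n r : ℕ} (F : Dom n → Matrix (Fin n) (Fin n) ℝ)
    (G : Dom n → Matrix (Fin r) (Fin n) ℝ)
    (A : Dom n → Matrix (Fin n ⊕ Fin r) (Fin n ⊕ Fin r) ℝ) : Prop :=
  MatSmoothOn Set.univ A ∧ (∀ x, A x ∈ Matrix.orthogonalGroup (Fin n ⊕ Fin r) ℝ) ∧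
    ∀ i x, (A x)⁻¹ * matPd i A x = tau F G i x

/-- `X : ℝⁿ → M_{m × n}` is smooth and `dX = -∑ᵢ A₁ Cᵢ Bᵗ dxᵢ`, where `A₁` consists of the first
`n` columns of `A`. -/
def IsPrimitiveII {n r : ℕ} (A : Dom n → Matrix (Fin n ⊕ Fin r) (Fin n ⊕ Fin r) ℝ)
    (B : Dom n → Matrix (Fin n) (Fin n) ℝ) (X : Dom n → Matrix (Fin n ⊕ Fin r) (Fin n) ℝ) :
    Prop :=
  MatSmoothOn Set.univ X ∧
    ∀ i x, matPd i X x = -((A x).submatrix id Sum.inl * diagUnit i * (B x)ᵀ)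

/-- The `j`-th column of a matrix-valued map, as a map into Euclidean space. -/
def column {n : ℕ} {ι κ : Type*} (M : Dom n → Matrix ι κ ℝ) (j : κ) :
    Dom n → EuclideanSpace ℝ ι :=
  fun x => WithLp.toLp 2 fun a => M x a j

section Submanifolds

variable {n : ℕ} {E : Type*} [NormedAddCommGroup E] [InnerProductSpace ℝ E]

/-- The tangent space of `X` at `x`, as a linear subspace of the ambient space. -/
def tangentPlane (X : Dom n → E) (x : Dom n) : Submodule ℝ E :=
  LinearMap.range (fderiv ℝ X x).toLinearMap

/-- The normal space of `X` at `x`. -/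
def normalPlane (X : Dom n → E) (x : Dom n) : Submodule ℝ E := (tangentPlane X x)ᗮ

/-- `X` is a smooth immersion of `O`. -/
def IsSmoothImmersionOn (O : Set (Dom n)) (X : Dom n → E) : Prop :=
  ContDiffOn ℝ ∞ X O ∧ ∀ x ∈ O, Function.Injective (fderiv ℝ X x)

/-- The first fundamental form, in the coordinates `x`. -/
def firstForm (X : Dom n → E) (x v w : Dom n) : ℝ := ⟪fderiv ℝ X x v, fderiv ℝ X x w⟫_ℝ

variable [FiniteDimensional ℝ E]

/-- The normal component of a vector at `x`. -/
def normalPart (X : Dom n → E) (x : Dom n) (u : E) : E := (normalPlane X x).starProjection u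

/-- The covariant derivative `∇^⊥_v ξ = (dξ(v))^⊥` at `x` in the normal bundle. -/
def normalDeriv (X : Dom n → E) (ξ : Dom n → E) (v x : Dom n) : E :=
  normalPart X x (fderiv ℝ ξ x v)

/-- The vector-valued second fundamental form, in the coordinates `x`, with the sign convention
`II = ∑ ⟨dX, de_α⟩ e_α` for an orthonormal normal frame `(e_α)`, that is,
`⟨II(v, w), ξ⟩ = ⟨dX(w), dξ(v)⟩` for normal fields `ξ`. Since `⟨dX(w), ξ⟩ = 0`, this is the
negative of the normal component of the second derivative of `X`. -/
def secondForm (X : Dom n → E) (x v w : Dom n) : E :=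
  -normalPart X x (fderiv ℝ (fun y => fderiv ℝ X y w) x v)

/-- The normal bundle of `X` over `O` is flat: the curvature of `∇^⊥` vanishes. (It is tested on
constant, hence commuting, coordinate vector fields `v`, `w`.) -/
def HasFlatNormalBundle (O : Set (Dom n)) (X : Dom n → E) : Prop :=
  ∀ ξ : Dom n → E, ContDiffOn ℝ ∞ ξ O → (∀ x ∈ O, ξ x ∈ normalPlane X x) →
    ∀ x ∈ O, ∀ v w,
      normalDeriv X (normalDeriv X ξ w) v x = normalDeriv X (normalDeriv X ξ v) w x

/-- The space of shape operators `A_ξ` at `x`, `ξ` in the normal space, where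
`⟨A_ξ v, w⟩ = ⟨II(v, w), ξ⟩`; the tangent space is identified with `ℝⁿ` by `dX`. -/
def shapeOperators (X : Dom n → E) (x : Dom n) : Submodule ℝ (Dom n →ₗ[ℝ] Dom n) :=
  Submodule.span ℝ {T | ∃ ξ ∈ normalPlane X x,
    ∀ v w, firstForm X x (T v) w = ⟪secondForm X x v w, ξ⟫_ℝ}

/-- The normal bundle is non-degenerate: the space of shape operators has dimension `n` at every
point. -/
def HasNondegenerateNormalBundle (O : Set (Dom n)) (X : Dom n → E) : Prop :=
  ∀ x ∈ O, Module.finrank ℝ (shapeOperators X x) = n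

/-- `(e₁, …, e_r)` is a smooth orthonormal parallel frame of normal fields of `X` on `O`
(used with `r` equal to the codimension). -/
structure IsParallelNormalFrame {r : ℕ} (O : Set (Dom n)) (X : Dom n → E)
    (e : Fin r → Dom n → E) : Prop where
  smooth : ∀ k, ContDiffOn ℝ ∞ (e k) O
  orthonormal : ∀ x ∈ O, Orthonormal ℝ fun k => e k x
  normal : ∀ k, ∀ x ∈ O, e k x ∈ normalPlane X x
  parallel : ∀ k, ∀ x ∈ O, ∀ v, normalDeriv X (e k) v x = 0

end Submanifolds

/-- `(X₁, …, X_n)` is an `n`-tuple in `ℝᵐ` of type `O(n)` on `O`, with common parallel normal frame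
`e` and with coefficient maps `B` and `G` of the fundamental forms:
`I_j = ∑ᵢ b_{ji}² dxᵢ²` and `II_j = ∑ᵢₖ b_{ji} g_{ki} dxᵢ² e_{n+k}`.
The coordinates are spherical line of curvature coordinates, as `∑ᵢ b_{ji}² = 1`. -/
structure IsTupleTypeOWith {n r : ℕ} (O : Set (Dom n)) (X : Fin n → Dom n → Amb n r)
    (e : Fin r → Dom n → Amb n r) (B : Dom n → Matrix (Fin n) (Fin n) ℝ)
    (G : Dom n → Matrix (Fin r) (Fin n) ℝ) : Prop where
  immersion : ∀ j, IsSmoothImmersionOn O (X j)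
  flat : ∀ j, HasFlatNormalBundle O (X j)
  normal_parallel : ∀ i j, ∀ x ∈ O, normalPlane (X i) x = normalPlane (X j) x
  frame : ∀ j, IsParallelNormalFrame O (X j) e
  smooth_B : MatSmoothOn O B
  smooth_G : MatSmoothOn O G
  orth_B : ∀ x ∈ O, B x ∈ Matrix.orthogonalGroup (Fin n) ℝ
  first_form : ∀ j, ∀ x ∈ O, ∀ v w,
    firstForm (X j) x v w = ∑ i, B x j i ^ 2 * (v i * w i)
  second_form : ∀ j, ∀ x ∈ O, ∀ v w,
    secondForm (X j) x v w = ∑ i, ∑ k, (B x j i * G x k i * (v i * w i)) • e k x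

/-- `(X₁, …, X_n)` is an `n`-tuple in `ℝᵐ` of type `O(n)` on `O`. -/
def IsTupleTypeO {n r : ℕ} (O : Set (Dom n)) (X : Fin n → Dom n → Amb n r) : Prop :=
  ∃ e B G, IsTupleTypeOWith O X e B G

/-- The matrix `F` with `f_{ij} = (b_{lj})_{xᵢ} / b_{li}` for `i ≠ j` and `f_{ii} = 0`, computed
from the `l`-th row of `B`. -/
def rowF {n : ℕ} (B : Dom n → Matrix (Fin n) (Fin n) ℝ) (l : Fin n) (x : Dom n) :
    Matrix (Fin n) (Fin n) ℝ :=
  Matrix.of fun i j => if i = j then 0 else pd i (fun y => B y l j) x / B x l i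

end GSystem

end

/-! Write e_1, ..., e_m for the columns of `A`. The equation A⁻¹ dA = τ gives ∂_i e_j = f_{ji} e_i
for i ≠ j and ∂_i e_{n+k} = g_{ki} e_i. The equations for F and G in the system are the flatness of
τ, and the equation for B is the closedness of ∑ b_{ji} e_i dx_i. From solutions to tuples: a flat
connection on ℝⁿ is integrated by the Frobenius theorem (`exists_hasFDerivAt_mul_of_flat`), obtained
by transport along rays from the origin, and skewness of τ keeps the solution orthogonal. The
Poincaré lemma `exists_pd_eq_of_closed` then yields X. Since ∂_i X_j = -b_{ji} e_i, the e_i span the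
tangent planes, the e_{n+k} are parallel normals, and both fundamental forms can be read off. Shape
operators are diagonal with entries -(Gᵗd)_i / b_{ji}, so their space has dimension rank G
(`finrank_shapeOperators`). From tuples to solutions: parallel normals satisfy ∂_i e_{n+k} =
(g_{ki}/b_{ji}) ∂_i X_j for every j (`IsTupleTypeOWith.vecPd_normal`). As no g_{ki} vanishes, E_i =
∂_i X_j / b_{ji} does not depend on j, so all X_j share one orthonormal tangent frame. Mixed
partials of all X_j together with the orthogonality of B force ∂_k E_i = f_{ik} E_k for k ≠ i, and
the system follows from commuting derivatives (`isSolutionII_of_movingFrame`). -/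

open scoped ContDiff Matrix InnerProductSpace

noncomputable section

namespace GSystem

/-! ### Linear equations in a Banach algebra and the Frobenius theorem. -/

section Frobenius

open Set Filter Topology

variable {𝔸 : Type*} [NormedRing 𝔸] [NormedAlgebra ℝ 𝔸]

/-- The terms of the Picard series of the linear equation `Y' = Y * M`. -/
def picardTerm (M : ℝ → 𝔸) : ℕ → ℝ → 𝔸
  | 0 => fun _ => 1
  | k + 1 => fun t => ∫ s in (0 : ℝ)..t, picardTerm M k s * M s

theorem continuous_picardTerm {M : ℝ → 𝔸} (hM : Continuous M) (k : ℕ) :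
    Continuous (picardTerm M k) := by
  induction k with
  | zero => exact continuous_const
  | succ k ih =>
    exact intervalIntegral.continuous_primitive
      (fun a b => (ih.mul hM).intervalIntegrable a b) 0

/-- Each integration of |s|^k contributes a factor 1/(k+1); the resulting factorial makes the Picard
series converge for every T. The factor ‖1‖ stays because the norm of the unit is not assumed to be
1. -/
theorem norm_picardTerm_le {M : ℝ → 𝔸} (hM : Continuous M) {K T : ℝ}
    (hK : ∀ t, |t| ≤ T → ‖M t‖ ≤ K) (k : ℕ) {t : ℝ} (ht : |t| ≤ T) :
    ‖picardTerm M k t‖ ≤ ‖(1 : 𝔸)‖ * (K ^ k * |t| ^ k / k.factorial) := by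
  have hK0 : 0 ≤ K := (norm_nonneg _).trans (hK t ht)
  induction k generalizing t with
  | zero => simp [picardTerm]
  | succ k ih =>
    have hc : Continuous fun s => picardTerm M k s * M s := (continuous_picardTerm hM k).mul hM
    have hmem : ∀ s ∈ uIoc 0 t, |s| ≤ T := fun s hs => by
      have := abs_sub_left_of_mem_uIcc (uIoc_subset_uIcc hs)
      simp only [sub_zero] at this
      exact this.trans ht
    calc ‖picardTerm M (k + 1) t‖ ≤ ∫ s in uIoc 0 t, ‖picardTerm M k s * M s‖ :=
          intervalIntegral.norm_integral_le_integral_norm_uIoc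
      _ ≤ ∫ s in uIoc 0 t, ‖(1 : 𝔸)‖ * (K ^ (k + 1) / k.factorial) * |s - 0| ^ k := by
          refine MeasureTheory.setIntegral_mono_on
            (hc.norm.integrableOn_uIoc) (Continuous.integrableOn_uIoc (by fun_prop))
            measurableSet_uIoc fun s hs => ?_
          calc ‖picardTerm M k s * M s‖ ≤ ‖picardTerm M k s‖ * ‖M s‖ := norm_mul_le _ _
            _ ≤ (‖(1 : 𝔸)‖ * (K ^ k * |s| ^ k / k.factorial)) * K := by
              gcongr
              · exact ih (hmem s hs)
              · exact hK s (hmem s hs)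
            _ = _ := by rw [sub_zero]; ring
      _ = _ := by
          rw [MeasureTheory.integral_const_mul, integral_pow_abs_sub_uIoc, sub_zero,
            Nat.factorial_succ]
          push_cast
          field_simp

variable {E : Type*} [NormedAddCommGroup E] [NormedSpace ℝ E]

/-- If Y is the transport along the ray through x, then Y(t)(1 + t τ(tx)h) is the first-order guess
for the transport along the ray through x + h. This bounds its defect in the differential equation
of the second ray. Flatness is exactly what cancels the terms linear in h. -/
theorem norm_transport_error_le {τ : E → E →L[ℝ] 𝔸} {s : Set E} (hs : Convex ℝ s)
    (hd : ∀ p ∈ s, DifferentiableAt ℝ τ p) {K L M R : ℝ}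
    (hK : ∀ p ∈ s, ‖τ p‖ ≤ K) (hL : ∀ p ∈ s, ‖fderiv ℝ τ p‖ ≤ L)
    (hM : ∀ p ∈ s, ∀ q ∈ s, ‖fderiv ℝ τ q - fderiv ℝ τ p‖ ≤ M * ‖q - p‖) (hM0 : 0 ≤ M)
    (hflat : ∀ p v w, fderiv ℝ τ p v w - fderiv ℝ τ p w v + (τ p v * τ p w - τ p w * τ p v) = 0)
    {x h : E} {t : ℝ} (ht : t ∈ Icc (0 : ℝ) 1) (hp : t • x ∈ s) (hq : t • (x + h) ∈ s)
    (hR : ‖x + h‖ ≤ R) :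
    ‖(τ (t • x) x * (1 + t • τ (t • x) h) + (τ (t • x) h + t • fderiv ℝ τ (t • x) x h))
      - (1 + t • τ (t • x) h) * τ (t • (x + h)) (x + h)‖ ≤
      (K * (L * R + K) + L + M * R) * ‖h‖ ^ 2 := by
  set p := t • x with hpdef
  set q := t • (x + h) with hqdef
  have hqp : q - p = t • h := by rw [hqdef, hpdef]; module
  have hK0 : 0 ≤ K := (norm_nonneg _).trans (hK p hp)
  have hL0 : 0 ≤ L := (norm_nonneg (fderiv ℝ τ p)).trans (hL p hp)
  have hR0 : 0 ≤ R := (norm_nonneg _).trans hR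
  have hth : ‖t • h‖ ≤ ‖h‖ := by
    rw [norm_smul, Real.norm_of_nonneg ht.1]
    exact mul_le_of_le_one_left (norm_nonneg _) ht.2
  have hsub : segment ℝ p q ⊆ s := hs.segment_subset hp hq
  have h1 : ‖τ q - τ p‖ ≤ L * ‖h‖ := by
    have := hs.norm_image_sub_le_of_norm_fderiv_le hd hL hp hq
    rw [hqp] at this
    exact this.trans (by gcongr)
  -- Second-order Taylor remainder: on the segment from p to q the derivative of τ varies by at most
  -- M‖h‖, and the mean value inequality supplies the other factor ‖h‖.
  have h2 : ‖τ q - τ p - fderiv ℝ τ p (t • h)‖ ≤ M * ‖h‖ ^ 2 := by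
    have := (convex_segment p q).norm_image_sub_le_of_norm_fderiv_le' (𝕜 := ℝ) (f := τ)
      (φ := fderiv ℝ τ p) (C := M * ‖h‖) (fun y hy => hd y (hsub hy)) (fun y hy => ?_)
      (left_mem_segment ℝ p q) (right_mem_segment ℝ p q)
    · rw [hqp] at this
      refine this.trans ?_
      rw [pow_two, ← mul_assoc]
      gcongr
    · refine (hM p hp y (hsub hy)).trans ?_
      gcongr
      refine le_trans ?_ hth
      rw [← hqp]
      exact norm_sub_le_of_mem_segment hy
  -- Flatness trades Dτ(x)h for Dτ(h)x plus a commutator; each of the three remaining terms is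
  -- quadratic in h.
  have key : (τ p x * (1 + t • τ p h) + (τ p h + t • fderiv ℝ τ p x h))
      - (1 + t • τ p h) * τ q (x + h) =
      -(t • (τ p h * ((τ q - τ p) (x + h) + τ p h))) - t • fderiv ℝ τ p h h
        - (τ q - τ p - fderiv ℝ τ p (t • h)) (x + h) := by
    have e : fderiv ℝ τ p x h = fderiv ℝ τ p h x - (τ p x * τ p h - τ p h * τ p x) := by
      have := hflat p x h
      rw [← sub_eq_zero, ← this]; abel
    rw [e]
    simp only [map_add, sub_apply, map_smul,
      smul_apply, mul_add, add_mul, mul_sub, smul_sub, smul_add, mul_one,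
      one_mul, smul_mul_assoc, mul_smul_comm]
    abel
  rw [key]
  have hKh : ‖τ p h‖ ≤ K * ‖h‖ := (τ p).le_of_opNorm_le (hK p hp) h
  have n1 : ‖t • (τ p h * ((τ q - τ p) (x + h) + τ p h))‖ ≤ K * (L * R + K) * ‖h‖ ^ 2 := by
    rw [norm_smul, Real.norm_of_nonneg ht.1]
    refine (mul_le_of_le_one_left (norm_nonneg _) ht.2).trans ?_
    calc _ ≤ ‖τ p h‖ * ‖(τ q - τ p) (x + h) + τ p h‖ := norm_mul_le _ _
      _ ≤ (K * ‖h‖) * ((L * ‖h‖) * R + K * ‖h‖) := by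
        gcongr
        refine (norm_add_le _ _).trans ?_
        gcongr
        refine ((τ q - τ p).le_opNorm _).trans ?_
        gcongr
      _ = _ := by ring
  have n2 : ‖t • fderiv ℝ τ p h h‖ ≤ L * ‖h‖ ^ 2 := by
    rw [norm_smul, Real.norm_of_nonneg ht.1]
    refine (mul_le_of_le_one_left (norm_nonneg _) ht.2).trans ?_
    refine ((fderiv ℝ τ p).le_opNorm₂ h h).trans ?_
    rw [mul_assoc, ← pow_two]
    gcongr
    exact hL p hp
  have n3 : ‖(τ q - τ p - fderiv ℝ τ p (t • h)) (x + h)‖ ≤ M * R * ‖h‖ ^ 2 := by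
    refine (ContinuousLinearMap.le_opNorm _ _).trans ?_
    calc _ ≤ (M * ‖h‖ ^ 2) * R := by gcongr
      _ = _ := by ring
  refine (norm_sub_le _ _).trans ?_
  have := norm_sub_le (-(t • (τ p h * ((τ q - τ p) (x + h) + τ p h)))) (t • fderiv ℝ τ p h h)
  rw [norm_neg] at this
  linarith

/-- Solutions of `dA = A τ` are as smooth as `τ` allows. -/
theorem contDiff_of_hasFDerivAt_mul {τ : E → E →L[ℝ] 𝔸} (hτ : ContDiff ℝ ∞ τ) {A : E → 𝔸}
    (hA : ∀ x, HasFDerivAt A ((ContinuousLinearMap.mul ℝ 𝔸 (A x)).comp (τ x)) x) :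
    ContDiff ℝ ∞ A := by
  refine contDiff_infty.2 fun k => ?_
  induction k with
  | zero => exact contDiff_zero.2 (continuous_iff_continuousAt.2 fun x => (hA x).continuousAt)
  | succ k ih =>
    have : fderiv ℝ A = fun x => (ContinuousLinearMap.mul ℝ 𝔸 (A x)).comp (τ x) :=
      funext fun x => (hA x).fderiv
    push_cast
    rw [contDiff_succ_iff_fderiv]
    refine ⟨fun x => (hA x).differentiableAt, by simp, ?_⟩
    rw [this]
    exact ((ContinuousLinearMap.mul ℝ 𝔸).contDiff.comp ih).clm_comp
      (hτ.of_le (by exact_mod_cast le_top))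

variable [CompleteSpace 𝔸]

theorem hasDerivAt_picardTerm_succ {M : ℝ → 𝔸} (hM : Continuous M) (k : ℕ) (t : ℝ) :
    HasDerivAt (picardTerm M (k + 1)) (picardTerm M k t * M t) t := by
  have hc : Continuous fun s => picardTerm M k s * M s := (continuous_picardTerm hM k).mul hM
  exact intervalIntegral.integral_hasDerivAt_right (hc.intervalIntegrable _ _)
    (hc.stronglyMeasurableAtFilter _ _) hc.continuousAt

/-- Linear differential equations `Y' = Y * M` in a Banach algebra have solutions with `Y 0 = 1`. -/
theorem exists_hasDerivAt_mul {M : ℝ → 𝔸} (hM : Continuous M) (T : ℝ) (hT : 0 < T) :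
    ∃ Y : ℝ → 𝔸, Y 0 = 1 ∧ ∀ t ∈ Ioo (-T) T, HasDerivAt Y (Y t * M t) t := by
  obtain ⟨K, hK⟩ : ∃ K, ∀ t, |t| ≤ T → ‖M t‖ ≤ K := by
    obtain ⟨K, hK⟩ := (isCompact_Icc (a := -T) (b := T)).exists_bound_of_continuousOn hM.continuousOn
    exact ⟨K, fun t ht => hK t (abs_le.1 ht)⟩
  have hK0 : 0 ≤ K := (norm_nonneg _).trans (hK 0 (by simpa using hT.le))
  have hterm0 : ∀ k, picardTerm M (k + 1) 0 = 0 := fun k => by simp [picardTerm]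
  have hbound : ∀ k, ∀ t ∈ Ioo (-T) T,
      ‖picardTerm M k t‖ ≤ ‖(1 : 𝔸)‖ * ((K * T) ^ k / k.factorial) := fun k t ht => by
    have ht' : |t| ≤ T := abs_le.2 ⟨ht.1.le, ht.2.le⟩
    refine (norm_picardTerm_le hM hK k ht').trans ?_
    rw [mul_pow]
    gcongr
  have hsum : Summable fun k : ℕ => ‖(1 : 𝔸)‖ * ((K * T) ^ k / k.factorial) :=
    (Real.summable_pow_div_factorial _).mul_left _
  have hsumm : ∀ t ∈ Ioo (-T) T, Summable fun k => picardTerm M k t := fun t ht =>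
    .of_norm_bounded hsum fun k => hbound k t ht
  have h0 : (0 : ℝ) ∈ Ioo (-T) T := ⟨by linarith, hT⟩
  have hd : ∀ t ∈ Ioo (-T) T, HasDerivAt (fun t => ∑' k, picardTerm M (k + 1) t)
      (∑' k, picardTerm M k t * M t) t := fun t ht => by
    -- The shifted series is differentiated term by term: its derivatives are dominated by an
    -- exponential series, and it converges at t = 0, where all its terms vanish.
    refine hasDerivAt_tsum_of_isPreconnected (hsum.mul_right K) isOpen_Ioo isPreconnected_Ioo
      (fun k s _ => hasDerivAt_picardTerm_succ hM k s) (fun k s hs => ?_) h0 (by simp [hterm0]) ht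
    refine (norm_mul_le _ _).trans ?_
    gcongr
    · exact hbound k s hs
    · exact hK s (abs_le.2 ⟨hs.1.le, hs.2.le⟩)
  refine ⟨fun t => 1 + ∑' k, picardTerm M (k + 1) t, by simp [hterm0], fun t ht => ?_⟩
  have h := (hd t ht).const_add 1
  convert! h using 1
  rw [(hsumm t ht).tsum_mul_right, (hsumm t ht).tsum_eq_zero_add]
  rfl


/-- **Frobenius theorem** for flat connections with values in a Banach algebra: if
`dτ + τ ∧ τ = 0`, then `dA = A τ` has a solution with `A 0 = 1`. -/
theorem exists_hasFDerivAt_mul_of_flat [FiniteDimensional ℝ E] {τ : E → E →L[ℝ] 𝔸}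
    (hτ : ContDiff ℝ 2 τ)
    (hflat : ∀ p v w, fderiv ℝ τ p v w - fderiv ℝ τ p w v + (τ p v * τ p w - τ p w * τ p v) = 0) :
    ∃ A : E → 𝔸, A 0 = 1 ∧
      ∀ x, HasFDerivAt A ((ContinuousLinearMap.mul ℝ 𝔸 (A x)).comp (τ x)) x := by
  have hτc : Continuous τ := hτ.continuous
  have hτd : Differentiable ℝ τ := hτ.differentiable two_ne_zero
  have hτ1 : ContDiff ℝ 1 (fderiv ℝ τ) := hτ.fderiv_right (by norm_num [one_add_one_eq_two])
  -- The value A(x) will be the transport along t ↦ tx at t = 1. The interval (-2, 2) contains [0,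
  -- 1] in its interior, so two-sided derivatives exist at both ends.
  have hray : ∀ x : E, ∃ Y : ℝ → 𝔸, Y 0 = 1 ∧
      ∀ t ∈ Ioo (-2 : ℝ) 2, HasDerivAt Y (Y t * τ (t • x) x) t := fun x =>
    exists_hasDerivAt_mul (M := fun t => τ (t • x) x) (by fun_prop) 2 two_pos
  choose Y hY0 hY using hray
  refine ⟨fun x => Y x 1, ?_, fun x => ?_⟩
  · have hc : ∀ t ∈ Icc (0 : ℝ) 1, Y 0 t = Y 0 0 := by
      refine constant_of_has_deriv_right_zero (fun t ht => ?_) fun t ht => ?_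
      · exact (hY 0 t ⟨by linarith [ht.1], by linarith [ht.2]⟩).continuousAt.continuousWithinAt
      · have := hY 0 t ⟨by linarith [ht.1], by linarith [ht.2]⟩
        rw [map_zero, mul_zero] at this
        exact this.hasDerivWithinAt
    exact (hc 1 (by simp)).trans (hY0 0)
  -- The ball of radius R contains the rays to x and to every x + h with ‖h‖ ≤ 1, so one set of
  -- compactness constants serves all such h.
  set R := ‖x‖ + 1 with hRdef
  set s := Metric.closedBall (0 : E) R with hsdef
  have hs : IsCompact s := isCompact_closedBall _ _
  have hsc : Convex ℝ s := convex_closedBall _ _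
  obtain ⟨K, hK⟩ := hs.exists_bound_of_continuousOn hτc.continuousOn
  obtain ⟨L, hL⟩ := hs.exists_bound_of_continuousOn (f := fderiv ℝ τ) hτ1.continuous.continuousOn
  obtain ⟨M, hM⟩ := hτ1.locallyLipschitz.locallyLipschitzOn.exists_lipschitzOnWith_of_compact hs
  have hx0 : (0 : E) ∈ s := by simp [hsdef, hRdef]; positivity
  have hK0 : 0 ≤ K := (norm_nonneg _).trans (hK 0 hx0)
  have hL0 : 0 ≤ L := (norm_nonneg (fderiv ℝ τ 0)).trans (hL 0 hx0)
  have hR0 : 0 ≤ R := by positivity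
  have hMl : ∀ p ∈ s, ∀ q ∈ s, ‖fderiv ℝ τ q - fderiv ℝ τ p‖ ≤ M * ‖q - p‖ :=
    fun p hp q hq => hM.norm_sub_le hq hp
  have hIoo : ∀ t ∈ Icc (0 : ℝ) 1, t ∈ Ioo (-2 : ℝ) 2 := fun t ht =>
    ⟨by linarith [ht.1], by linarith [ht.2]⟩
  obtain ⟨Q, hQ⟩ := (isCompact_Icc (a := (0 : ℝ)) (b := 1)).exists_bound_of_continuousOn
    (fun t ht => (hY x t (hIoo t ht)).continuousAt.continuousWithinAt)
  have hQ0 : 0 ≤ Q := (norm_nonneg _).trans (hQ 0 (by simp))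
  set C := Q * (K * (L * R + K) + L + M * R) with hCdef
  -- With zero initial error the Grönwall bound is linear in the defect, so its value at defect 1 is
  -- the constant multiplying C‖h‖².
  set c := gronwallBound 0 (K * R) 1 1 with hcdef
  have hball : ∀ y : E, ‖y‖ ≤ R → ∀ t ∈ Icc (0 : ℝ) 1, t • y ∈ s := fun y hy t ht => by
    rw [hsdef, mem_closedBall_zero_iff, norm_smul, Real.norm_of_nonneg ht.1]
    exact (mul_le_of_le_one_left (norm_nonneg _) ht.2).trans hy
  have main : ∀ h : E, ‖h‖ ≤ 1 →
      ‖Y x 1 * (1 + τ x h) - Y (x + h) 1‖ ≤ c * C * ‖h‖ ^ 2 := fun h hh => by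
    have hxh : ‖x + h‖ ≤ R := (norm_add_le _ _).trans (by rw [hRdef]; gcongr)
    have hxR : ‖x‖ ≤ R := by rw [hRdef]; linarith
    have hτh : ∀ t : ℝ, HasDerivAt (fun t : ℝ => τ (t • x) h) (fderiv ℝ τ (t • x) x h) t :=
      fun t => by
        have h1 : HasDerivAt (fun t : ℝ => t • x) x t := by
          simpa using (hasDerivAt_id t).smul_const x
        have h2 := ((hτd (t • x)).hasFDerivAt.comp_hasDerivAt t h1)
        exact h2.clm_apply (hasDerivAt_const t h) |>.congr_deriv (by simp)
    have hW : ∀ t ∈ Icc (0 : ℝ) 1, HasDerivAt (fun t => Y x t * (1 + t • τ (t • x) h))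
        (Y x t * (τ (t • x) x * (1 + t • τ (t • x) h)
          + (τ (t • x) h + t • fderiv ℝ τ (t • x) x h))) t := fun t ht => by
      have h2 := ((hasDerivAt_id t).fun_smul (hτh t)).const_add 1
      refine ((hY x t (hIoo t ht)).mul h2).congr_deriv ?_
      simp only [id, one_smul, mul_add, mul_assoc]
      abel
    have hZ : ∀ t ∈ Icc (0 : ℝ) 1,
        HasDerivAt (fun t => Y x t * (1 + t • τ (t • x) h) - Y (x + h) t)
        (Y x t * (τ (t • x) x * (1 + t • τ (t • x) h)
          + (τ (t • x) h + t • fderiv ℝ τ (t • x) x h))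
          - Y (x + h) t * τ (t • (x + h)) (x + h)) t := fun t ht =>
      (hW t ht).sub (hY (x + h) t (hIoo t ht))
    have hg := norm_le_gronwallBound_of_norm_deriv_right_le (δ := 0) (K := K * R)
      (ε := C * ‖h‖ ^ 2) (a := 0) (b := 1)
      (fun t ht => (hZ t ht).continuousAt.continuousWithinAt)
      (fun t ht => (hZ t ⟨ht.1, ht.2.le⟩).hasDerivWithinAt) (by simp [hY0])
      (fun t ht => ?_) 1 (by simp)
    · simp only [one_smul, sub_zero] at hg
      refine hg.trans (le_of_eq ?_)
      rw [hcdef]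
      by_cases hKR : K * R = 0
      · rw [hKR, gronwallBound_K0, gronwallBound_K0]; ring
      · rw [gronwallBound_of_K_ne_0 hKR, gronwallBound_of_K_ne_0 hKR]; ring
    · have ht' : t ∈ Icc (0 : ℝ) 1 := ⟨ht.1, ht.2.le⟩
      have herr := norm_transport_error_le hsc (fun p _ => hτd p) hK hL hMl M.coe_nonneg hflat ht'
        (hball x hxR t ht') (hball (x + h) hxh t ht') hxh
      -- The error Z satisfies Z' = Z τ + Y · (defect): a Grönwall inequality whose inhomogeneous
      -- part is the quadratic bound.
      have hsplit : Y x t * (τ (t • x) x * (1 + t • τ (t • x) h)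
          + (τ (t • x) h + t • fderiv ℝ τ (t • x) x h))
          - Y (x + h) t * τ (t • (x + h)) (x + h) =
          (Y x t * (1 + t • τ (t • x) h) - Y (x + h) t) * τ (t • (x + h)) (x + h)
          + Y x t * ((τ (t • x) x * (1 + t • τ (t • x) h)
            + (τ (t • x) h + t • fderiv ℝ τ (t • x) x h))
            - (1 + t • τ (t • x) h) * τ (t • (x + h)) (x + h)) := by
        rw [mul_sub, sub_mul, mul_assoc (Y x t) (1 + t • τ (t • x) h)]
        abel
      rw [hsplit]
      refine (norm_add_le _ _).trans (add_le_add ?_ ?_)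
      · rw [mul_comm (K * R)]
        refine (norm_mul_le _ _).trans ?_
        gcongr
        refine ((τ (t • (x + h))).le_opNorm _).trans ?_
        gcongr
        exact hK _ (hball (x + h) hxh t ht')
      · refine (norm_mul_le _ _).trans ?_
        rw [hCdef, mul_assoc]
        gcongr
        exact hQ t ht'
  rw [hasFDerivAt_iff_isLittleO_nhds_zero]
  refine Asymptotics.IsBigO.trans_isLittleO (g := fun h : E => ‖h‖ ^ 2) ?_ ?_
  · refine Asymptotics.IsBigO.of_bound (c * C) ?_
    filter_upwards [Metric.closedBall_mem_nhds (0 : E) one_pos] with h hh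
    rw [mem_closedBall_zero_iff] at hh
    rw [Real.norm_of_nonneg (sq_nonneg _), ← norm_neg]
    refine (le_of_eq ?_).trans (main h hh)
    congr 1
    change -(Y (x + h) 1 - Y x 1 - Y x 1 * τ x h) = _
    rw [mul_add, mul_one]
    abel
  · exact Asymptotics.isLittleO_norm_pow_id one_lt_two

end Frobenius

theorem clm_apply_eq_sum {n : ℕ} {F : Type*} [NormedAddCommGroup F] [NormedSpace ℝ F]
    (L : Dom n →L[ℝ] F) (v : Dom n) : L v = ∑ i, v i • L (EuclideanSpace.single i 1) := by
  conv_lhs => rw [← (EuclideanSpace.basisFun (Fin n) ℝ).sum_repr v]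
  simp [map_sum]

/-! ### Frobenius in coordinates, and unitarity of solutions. -/

section BanachAlgebra

variable {n : ℕ} {𝔸 : Type*} [NormedRing 𝔸] [NormedAlgebra ℝ 𝔸]

/-- The Frobenius theorem for flat connections on `ℝⁿ` with values in a Banach algebra, in
coordinates. -/
theorem exists_partial_eq_mul_of_flat [CompleteSpace 𝔸] {θ : Fin n → Dom n → 𝔸} (hs : ∀ i, ContDiff ℝ ∞ (θ i))
    (hflat : ∀ i j x, fderiv ℝ (θ j) x (EuclideanSpace.single i 1)
      - fderiv ℝ (θ i) x (EuclideanSpace.single j 1) + (θ i x * θ j x - θ j x * θ i x) = 0) :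
    ∃ A : Dom n → 𝔸, A 0 = 1 ∧ ContDiff ℝ ∞ A ∧
      ∀ i x, fderiv ℝ A x (EuclideanSpace.single i 1) = A x * θ i x := by
  have hd : ∀ i, Differentiable ℝ (θ i) := fun i => (hs i).differentiable (by simp)
  set τ : Dom n → Dom n →L[ℝ] 𝔸 := fun x =>
    ∑ i, (EuclideanSpace.proj i : Dom n →L[ℝ] ℝ).smulRight (θ i x) with hτdef
  have hτapp : ∀ x v, τ x v = ∑ i, v i • θ i x := fun x v => by simp [hτdef]
  have hτs : ContDiff ℝ ∞ τ := ContDiff.sum fun i _ => contDiff_const.smulRight (hs i)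
  have hτd : Differentiable ℝ τ := hτs.differentiable (by simp)
  have hτ' : ∀ p v w, fderiv ℝ τ p v w =
      ∑ i, ∑ j, (v i * w j) • fderiv ℝ (θ j) p (EuclideanSpace.single i 1) := fun p v w => by
    have h1 : fderiv ℝ τ p v w = fderiv ℝ (fun q => τ q w) p v := by
      rw [fderiv_clm_apply (hτd p) (differentiableAt_const w)]
      simp
    have h2 : (fun q => τ q w) = fun q => ∑ j, w j • θ j q := funext fun q => hτapp q w
    rw [h1, h2, clm_apply_eq_sum]
    refine Finset.sum_congr rfl fun i _ => ?_
    rw [fderiv_fun_sum fun j _ => (hd j p).fun_const_smul (w j), sum_apply, Finset.smul_sum]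
    refine Finset.sum_congr rfl fun j _ => ?_
    rw [fderiv_fun_const_smul (hd j p), smul_apply, smul_smul]
  -- Flatness on pairs of coordinate vectors extends to all v, w by bilinearity.
  obtain ⟨A, hA0, hA⟩ := exists_hasFDerivAt_mul_of_flat (τ := τ)
    (by exact_mod_cast contDiff_infty.1 hτs 2) fun p v w => by
      have hmul : ∀ v w, τ p v * τ p w = ∑ i, ∑ j, (v i * w j) • (θ i p * θ j p) := fun v w => by
        simp only [hτapp, Finset.sum_mul_sum, smul_mul_assoc, mul_smul_comm, smul_smul, mul_comm]
      have hswap : ∀ f : Fin n → Fin n → 𝔸,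
          ∑ i, ∑ j, (w i * v j) • f i j = ∑ i, ∑ j, (v i * w j) • f j i := fun f => by
        rw [Finset.sum_comm]
        exact Finset.sum_congr rfl fun i _ => Finset.sum_congr rfl fun j _ => by rw [mul_comm]
      rw [hτ', hτ', hmul, hmul, hswap, hswap]
      simp only [← Finset.sum_sub_distrib, ← Finset.sum_add_distrib, ← smul_sub, ← smul_add,
        hflat, smul_zero, Finset.sum_const_zero]
  refine ⟨A, hA0, contDiff_of_hasFDerivAt_mul hτs hA, fun i x => ?_⟩
  rw [(hA x).fderiv]
  change A x * τ x (EuclideanSpace.single i 1) = _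
  congr 1
  rw [hτapp]
  simp

/-- The derivative of A A* is A(θ + θ*)A* = 0, so A A* keeps its value at the origin. -/
theorem mul_star_eq_one_of_partial_eq_mul [StarRing 𝔸] [NormedStarGroup 𝔸] [StarModule ℝ 𝔸]
    {θ : Fin n → Dom n → 𝔸} (hskew : ∀ i x, star (θ i x) = -θ i x) {A : Dom n → 𝔸}
    (hA0 : A 0 = 1) (hA : Differentiable ℝ A)
    (hA' : ∀ i x, fderiv ℝ A x (EuclideanSpace.single i 1) = A x * θ i x) (x : Dom n) :
    A x * star (A x) = 1 := by
  have hd : Differentiable ℝ fun y => A y * star (A y) := hA.mul hA.star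
  have := is_const_of_fderiv_eq_zero (𝕜 := ℝ) hd (fun y => ?_) x 0
  · simpa [hA0] using this
  · ext v
    rw [clm_apply_eq_sum]
    refine Finset.sum_eq_zero fun i _ => ?_
    rw [fderiv_fun_mul' (hA y) (hA.star y), fderiv_star]
    simp [hA', hskew, mul_assoc]

end BanachAlgebra

/-! ### Flat matrix connections. -/

section MatrixMaps

variable {n : ℕ} {ι : Type*} [Fintype ι] [DecidableEq ι]

theorem fderiv_sum_sum_smul {ι κ E V : Type*} [Fintype ι] [Fintype κ] [NormedAddCommGroup E]
    [NormedSpace ℝ E] [NormedAddCommGroup V] [NormedSpace ℝ V] {g : ι → κ → E → ℝ} {x : E}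
    (hg : ∀ a b, DifferentiableAt ℝ (g a b) x) (c : ι → κ → V) (v : E) :
    fderiv ℝ (fun y => ∑ a, ∑ b, g a b y • c a b) x v =
      ∑ a, ∑ b, fderiv ℝ (g a b) x v • c a b := by
  have h := HasFDerivAt.fun_sum (u := Finset.univ) fun a _ =>
    HasFDerivAt.fun_sum (u := Finset.univ) fun b _ => (hg a b).hasFDerivAt.smul_const (c a b)
  rw [h.fderiv]
  simp

theorem fderiv_clm_comp {E V W : Type*} [NormedAddCommGroup E] [NormedSpace ℝ E]
    [NormedAddCommGroup V] [NormedSpace ℝ V] [NormedAddCommGroup W] [NormedSpace ℝ W]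
    (L : V →L[ℝ] W) {f : E → V} {x : E} (hf : DifferentiableAt ℝ f x) (v : E) :
    fderiv ℝ (fun y => L (f y)) x v = L (fderiv ℝ f x v) := by
  have h := L.hasFDerivAt.comp x hf.hasFDerivAt
  exact congrArg (· v) h.fderiv

/-- Transport of structure: the differential equation is solved in a complete normed star algebra
isomorphic to the matrices. In finite dimensions φ and the entries of its inverse are continuous
linear maps, so smoothness and partial derivatives pass both ways. -/
theorem IsFlatConnection.exists_orthogonal_frame_of_starAlgEquiv {𝔸 : Type*} [NormedRing 𝔸]
    [NormedAlgebra ℝ 𝔸] [CompleteSpace 𝔸] [StarRing 𝔸] [NormedStarGroup 𝔸] [StarModule ℝ 𝔸]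
    (φ : Matrix ι ι ℝ ≃⋆ₐ[ℝ] 𝔸) {θ : Fin n → Dom n → Matrix ι ι ℝ}
    (hθ : IsFlatConnection θ) :
    ∃ A : Dom n → Matrix ι ι ℝ, MatSmoothOn Set.univ A ∧
      (∀ x, A x ∈ Matrix.orthogonalGroup ι ℝ) ∧ ∀ i x, matPd i A x = A x * θ i x := by
  obtain ⟨hsmooth, hskew, hflat⟩ := hθ
  have hfin : FiniteDimensional ℝ 𝔸 := φ.toAlgEquiv.toLinearEquiv.finiteDimensional
  have hφsum : ∀ M : Matrix ι ι ℝ, φ M = ∑ a, ∑ b, M a b • φ (Matrix.single a b 1) := fun M => by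
    conv_lhs => rw [Matrix.matrix_eq_sum_single M]
    simp only [map_sum, ← map_smul, Matrix.smul_single, smul_eq_mul, mul_one]
  have hs : ∀ a b i, ContDiff ℝ ∞ fun y => θ i y a b := fun a b i =>
    contDiffOn_univ.1 (hsmooth i a b)
  have hφθ : ∀ i, (fun y => φ (θ i y)) = fun y => ∑ a, ∑ b, θ i y a b • φ (Matrix.single a b 1) :=
    fun i => funext fun y => hφsum (θ i y)
  have hφpd : ∀ i j x, fderiv ℝ (fun y => φ (θ j y)) x (EuclideanSpace.single i 1) =
      φ (matPd i (θ j) x) := fun i j x => by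
    have hd : ∀ a b, DifferentiableAt ℝ (fun y => θ j y a b) x := fun a b =>
      (hs a b j).differentiable (by simp) x
    rw [hφθ, hφsum]
    exact fderiv_sum_sum_smul hd _ _
  obtain ⟨A, hA0, hAs, hA⟩ := exists_partial_eq_mul_of_flat (θ := fun i y => φ (θ i y))
    (fun i => by
      rw [hφθ]
      exact ContDiff.sum fun a _ => ContDiff.sum fun b _ => (hs a b i).smul contDiff_const)
    (fun i j x => by
      rw [hφpd, hφpd, ← map_mul, ← map_mul, ← map_sub, ← map_sub, ← map_add, hflat, map_zero])
  have horth := mul_star_eq_one_of_partial_eq_mul (θ := fun i y => φ (θ i y))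
    (fun i x => by
      rw [← map_star, Matrix.star_eq_conjTranspose, Matrix.conjTranspose_eq_transpose_of_trivial,
        hskew, map_neg]) hA0 (hAs.differentiable (by simp)) hA
  have hentry : ∀ a b, ∃ L : 𝔸 →L[ℝ] ℝ,
      ∀ T, L T = φ.symm T a b := fun a b =>
    ⟨LinearMap.toContinuousLinearMap ((Matrix.entryLinearMap ℝ ℝ a b).comp
      φ.symm.toAlgEquiv.toLinearMap), fun T => rfl⟩
  choose L hL using hentry
  refine ⟨fun y => φ.symm (A y), fun a b => ?_, fun x => ?_, fun i x => ?_⟩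
  · simp only [← hL]
    exact ((L a b).contDiff.comp hAs).contDiffOn
  · rw [Matrix.mem_orthogonalGroup_iff, ← Matrix.conjTranspose_eq_transpose_of_trivial,
      ← Matrix.star_eq_conjTranspose]
    change φ.symm (A x) * star (φ.symm (A x)) = 1
    rw [← map_star, ← map_mul, horth, map_one]
  · ext a b
    have h1 : matPd i (fun y => φ.symm (A y)) x a b =
        fderiv ℝ (fun y => L a b (A y)) x (EuclideanSpace.single i 1) := by
      simp only [hL]
      rfl
    rw [h1, fderiv_clm_comp _ (hAs.differentiable (by simp) x), hA, hL, map_mul]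
    simp

/-- A flat `o(m)`-valued connection on `ℝⁿ` is `A⁻¹ dA` for a map `A` into the orthogonal group. -/
theorem IsFlatConnection.exists_orthogonal_frame {θ : Fin n → Dom n → Matrix ι ι ℝ}
    (hθ : IsFlatConnection θ) :
    ∃ A : Dom n → Matrix ι ι ℝ, MatSmoothOn Set.univ A ∧
      (∀ x, A x ∈ Matrix.orthogonalGroup ι ℝ) ∧ ∀ i x, matPd i A x = A x * θ i x :=
  hθ.exists_orthogonal_frame_of_starAlgEquiv (Matrix.toEuclideanCLM (n := ι) (𝕜 := ℝ))

end MatrixMaps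

/-- The Poincaré lemma for smooth closed 1-forms on `ℝⁿ`. -/
theorem exists_pd_eq_of_closed {n : ℕ} {p : Fin n → Dom n → ℝ} (hp : ∀ i, ContDiff ℝ ∞ (p i))
    (hclosed : ∀ i j x, pd i (p j) x = pd j (p i) x) :
    ∃ f : Dom n → ℝ, ContDiff ℝ ∞ f ∧ ∀ i x, pd i f x = p i x := by
  have hd : ∀ i, Differentiable ℝ (p i) := fun i => (hp i).differentiable (by simp)
  set η : Dom n → Dom n →L[ℝ] ℝ := fun x =>
    ∑ i, (EuclideanSpace.proj i : Dom n →L[ℝ] ℝ).smulRight (p i x) with hηdef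
  have hηapp : ∀ x v, η x v = ∑ i, v i * p i x := fun x v => by simp [hηdef]
  have hηs : ContDiff ℝ ∞ η := ContDiff.sum fun i _ => contDiff_const.smulRight (hp i)
  have hηd : Differentiable ℝ η := hηs.differentiable (by simp)
  have hη' : ∀ x v w, fderiv ℝ η x v w = ∑ i, ∑ j, v i * w j * pd i (p j) x := fun x v w => by
    have h1 : fderiv ℝ η x v w = fderiv ℝ (fun q => η q w) x v := by
      rw [fderiv_clm_apply (hηd x) (differentiableAt_const w)]
      simp
    have h2 : (fun q => η q w) = fun q => ∑ j, w j * p j q := funext fun q => hηapp q w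
    rw [h1, h2, clm_apply_eq_sum]
    refine Finset.sum_congr rfl fun i _ => ?_
    rw [fderiv_fun_sum fun j _ => (hd j x).const_mul (w j), sum_apply, Finset.smul_sum]
    refine Finset.sum_congr rfl fun j _ => ?_
    rw [fderiv_const_mul (hd j x), smul_apply, smul_eq_mul, smul_eq_mul, mul_assoc]
    rfl
  obtain ⟨f, hf⟩ := convex_univ.exists_forall_hasFDerivAt_of_fderiv_symmetric isOpen_univ
    hηd.differentiableOn fun x _ v w => by
      rw [hη', hη', Finset.sum_comm]
      exact Finset.sum_congr rfl fun i _ => Finset.sum_congr rfl fun j _ => by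
        rw [hclosed, mul_comm (v j)]
  have hf' : ∀ x, HasFDerivAt f (η x) x := fun x => hf x (Set.mem_univ x)
  refine ⟨f, ?_, fun i x => ?_⟩
  · rw [contDiff_infty_iff_fderiv]
    refine ⟨fun x => (hf' x).differentiableAt, ?_⟩
    rwa [show fderiv ℝ f = η from funext fun x => (hf' x).fderiv]
  · rw [pd, (hf' x).fderiv, hηapp]
    simp

/-! ### Flatness of the connection τ. -/

section Tau

variable {n r : ℕ} {F : Dom n → Matrix (Fin n) (Fin n) ℝ} {G : Dom n → Matrix (Fin r) (Fin n) ℝ}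
  {x : Dom n}

theorem mul_diagUnit_apply {κ : Type*} (M : Matrix κ (Fin n) ℝ) (i : Fin n) (a : κ) (b : Fin n) :
    (M * diagUnit i) a b = if b = i then M a i else 0 := by
  rw [diagUnit]
  split_ifs with h
  · subst h; simp
  · simp [h]

theorem diagUnit_mul_apply {κ : Type*} (M : Matrix (Fin n) κ ℝ) (i : Fin n) (a : Fin n) (b : κ) :
    (diagUnit i * M) a b = if a = i then M i b else 0 := by
  rw [diagUnit]
  split_ifs with h
  · subst h; simp
  · simp [h]

theorem tau_inl_inl (i a b : Fin n) : tau F G i x (Sum.inl a) (Sum.inl b) =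
    (if a = i then F x b i else 0) - (if b = i then F x a i else 0) := by
  simp [tau, mul_diagUnit_apply, diagUnit_mul_apply]
  ring

theorem tau_inl_inr (i a : Fin n) (k : Fin r) : tau F G i x (Sum.inl a) (Sum.inr k) =
    if a = i then G x k i else 0 := by
  simp [tau, diagUnit_mul_apply]

theorem tau_inr_inl (i b : Fin n) (k : Fin r) : tau F G i x (Sum.inr k) (Sum.inl b) =
    -if b = i then G x k i else 0 := by
  simp [tau, mul_diagUnit_apply]

theorem tau_inr_inr (i : Fin n) (k l : Fin r) : tau F G i x (Sum.inr k) (Sum.inr l) = 0 := by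
  simp [tau]

theorem tau_transpose (i : Fin n) : (tau F G i x)ᵀ = -tau F G i x := by
  ext (a | a) (b | b) <;> simp [tau_inl_inl, tau_inl_inr, tau_inr_inl, tau_inr_inr]

theorem matSmoothOn_tau {O : Set (Dom n)} (hF : MatSmoothOn O F) (hG : MatSmoothOn O G)
    (i : Fin n) : MatSmoothOn O (tau F G i) := by
  rintro (a | a) (b | b)
  · simp only [tau_inl_inl]
    refine ContDiffOn.sub ?_ ?_ <;> split_ifs <;> first | exact hF _ _ | exact contDiffOn_const
  · simp only [tau_inl_inr]
    split_ifs <;> first | exact hG _ _ | exact contDiffOn_const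
  · simp only [tau_inr_inl]
    refine ContDiffOn.neg ?_
    split_ifs <;> first | exact hG _ _ | exact contDiffOn_const
  · simp only [tau_inr_inr]
    exact contDiffOn_const

theorem pd_const (i : Fin n) (c : ℝ) : pd i (fun _ => c) x = 0 := by simp [pd]

theorem pd_neg (i : Fin n) (f : Dom n → ℝ) : pd i (fun y => -f y) x = -pd i f x := by
  simp [pd, fderiv_fun_neg]

theorem pd_sub {i : Fin n} {f g : Dom n → ℝ} (hf : DifferentiableAt ℝ f x)
    (hg : DifferentiableAt ℝ g x) : pd i (fun y => f y - g y) x = pd i f x - pd i g x := by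
  simp [pd, fderiv_fun_sub hf hg]

theorem pd_mul {i : Fin n} {f g : Dom n → ℝ} (hf : DifferentiableAt ℝ f x)
    (hg : DifferentiableAt ℝ g x) :
    pd i (fun y => f y * g y) x = pd i f x * g x + f x * pd i g x := by
  simp [pd, fderiv_fun_mul hf hg]
  ring

theorem pd_ite {i : Fin n} (f : Dom n → ℝ) (P : Prop) [Decidable P] :
    pd i (fun y => if P then f y else 0) x = if P then pd i f x else 0 := by
  split_ifs
  · rfl
  · exact pd_const i 0

/-- The full sums ∑ f f + ∑ g g of the Gauss equation occur only in the entry (i, j), from row i of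
the first factor against column j of the second. -/
theorem tau_mul_tau_inl_inl (i j a b : Fin n) :
    (tau F G i x * tau F G j x) (Sum.inl a) (Sum.inl b) =
      (if a = i then F x j i * F x b j else 0)
        - (if a = i then if b = j then ∑ c, F x c i * F x c j + ∑ k, G x k i * G x k j else 0
          else 0)
        - (if i = j then F x a i * F x b j else 0) + (if b = j then F x a i * F x i j else 0) := by
  simp only [Matrix.mul_apply, Fintype.sum_sum_type, tau_inl_inl, tau_inl_inr, tau_inr_inl,
    sub_mul, mul_sub, Finset.sum_sub_distrib, ite_mul, mul_ite, zero_mul, mul_zero, mul_neg,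
    Finset.sum_neg_distrib, Finset.sum_ite_eq', Finset.mem_univ, if_true]
  by_cases ha : a = i <;> by_cases hb : b = j <;> (simp [ha, hb, eq_comm]; try ring)

theorem tau_mul_tau_inl_inr (i j a : Fin n) (k : Fin r) :
    (tau F G i x * tau F G j x) (Sum.inl a) (Sum.inr k) =
      (if a = i then F x j i * G x k j else 0) - (if i = j then F x a i * G x k j else 0) := by
  simp only [Matrix.mul_apply, Fintype.sum_sum_type, tau_inl_inl, tau_inl_inr, tau_inr_inr,
    sub_mul, ite_mul, mul_ite, zero_mul, mul_zero,
    Finset.sum_const_zero, add_zero, Finset.sum_ite_eq', Finset.mem_univ, if_true]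
  by_cases ha : a = i <;> simp [ha, eq_comm]

theorem tau_mul_tau_inr_inr (i j : Fin n) (k l : Fin r) :
    (tau F G i x * tau F G j x) (Sum.inr k) (Sum.inr l) =
      -if i = j then G x k i * G x l j else 0 := by
  simp [Matrix.mul_apply, tau_inr_inl, tau_inl_inr, tau_inr_inr, eq_comm]

/-- Entry by entry for i ≠ j: the tangential entries (i, j) and (j, i) give the Gauss equation,
tangential entries with exactly one index in {i, j} give the equations for F, the mixed blocks give
those for G, and the rest vanishes identically. -/
theorem IsSolutionII.isFlatConnection_tau {B : Dom n → Matrix (Fin n) (Fin n) ℝ}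
    (h : IsSolutionII Set.univ F G B) : IsFlatConnection (tau F G) := by
  refine ⟨matSmoothOn_tau h.smooth_F h.smooth_G, fun i x => tau_transpose i, fun i j x => ?_⟩
  by_cases hij : i = j
  · subst hij; simp
  have hji : j ≠ i := Ne.symm hij
  have hx := Set.mem_univ x
  have hF : ∀ (P : Prop) [Decidable P] a b,
      DifferentiableAt ℝ (fun y => if P then F y a b else 0) x := fun P _ a b => by
    split_ifs
    · exact ((contDiffOn_univ.1 (h.smooth_F a b)).differentiable (by simp)) x
    · exact differentiableAt_const _
  have hdiag := fun a => h.diag_F x hx a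
  have hG : ∀ (a : Fin n) (k : Fin r),
      (if a = j then pd i (fun y => G y k j) x else 0)
        - (if a = i then pd j (fun y => G y k i) x else 0)
        + ((if a = i then F x j i * G x k j else 0)
          - (if a = j then F x i j * G x k i else 0)) = 0 := fun a k => by
    rw [h.eq_G x hx k j i hji, h.eq_G x hx k i j hij]
    split_ifs <;> ring
  ext (a | a) (b | b)
  · simp only [Matrix.add_apply, Matrix.sub_apply, Matrix.zero_apply, matPd, Matrix.of_apply,
      tau_mul_tau_inl_inl, tau_inl_inl, pd_sub (hF _ _ _) (hF _ _ _), pd_ite, if_neg hij,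
      if_neg hji]
    have hgauss := h.eq_gauss x hx i j hij
    have hcomm : ∀ {κ : Type} [Fintype κ] (M : Matrix κ (Fin n) ℝ),
        ∑ k, M k j * M k i = ∑ k, M k i * M k j := fun M =>
      Finset.sum_congr rfl fun k _ => mul_comm _ _
    have hFF : ∀ a i j : Fin n, a ≠ i → a ≠ j → i ≠ j →
        pd i (fun y => F y a j) x = F x a i * F x i j :=
      fun a i j hai haj hij => h.eq_F x hx a j i haj hij.symm hai
    rw [hcomm (F x), hcomm (G x)]
    by_cases hai : a = i
    · subst hai
      by_cases hbj : b = j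
      · subst hbj
        simp [hij, hji, hdiag]
        linarith
      · by_cases hba : b = a
        · subst hba
          simp [hij]
          ring
        · simp [hij, hba, hbj, hFF b j a hbj hba hji]
          ring
    · by_cases haj : a = j
      · subst haj
        by_cases hbi : b = i
        · subst hbi
          simp [hij, hji, hdiag]
          linarith
        · by_cases hba : b = a
          · subst hba
            simp [hji]
            ring
          · simp [hji, hba, hbi, hFF b i a hbi hba hij]
            ring
      · by_cases hbi : b = i
        · subst hbi
          simp [hai, haj, hij, hFF a j b haj hai hji]
        · by_cases hbj : b = j
          · subst hbj
            simp [hai, haj, hji, hFF a i b hai haj hij]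
          · simp [hai, haj, hbi, hbj]
  · simp only [Matrix.add_apply, Matrix.sub_apply, Matrix.zero_apply, matPd, Matrix.of_apply,
      tau_mul_tau_inl_inr, tau_inl_inr, pd_ite, if_neg hij, if_neg hji, sub_zero]
    exact hG a b
  -- Skewness gives (τ_i τ_j)ᵗ = τ_j τ_i, which reduces the lower left block to the upper right one.
  · have hskew : ∀ i (y : Dom n), tau F G i y (Sum.inr a) (Sum.inl b) =
        -tau F G i y (Sum.inl b) (Sum.inr a) := fun i y =>
      congrFun (congrFun (tau_transpose (F := F) (G := G) (x := y) i) (Sum.inl b)) (Sum.inr a)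
    have hmul : ∀ i j, (tau F G i x * tau F G j x) (Sum.inr a) (Sum.inl b) =
        (tau F G j x * tau F G i x) (Sum.inl b) (Sum.inr a) := fun i j => by
      rw [← Matrix.transpose_apply (tau F G i x * tau F G j x), Matrix.transpose_mul,
        tau_transpose, tau_transpose, neg_mul_neg]
    simp only [Matrix.add_apply, Matrix.sub_apply, Matrix.zero_apply, matPd, Matrix.of_apply,
      hskew, hmul, tau_mul_tau_inl_inr, tau_inl_inr, pd_neg, pd_ite, if_neg hij, if_neg hji,
      sub_zero]
    linarith [hG b a]
  · simp [Matrix.add_apply, Matrix.sub_apply, matPd, tau_mul_tau_inr_inr, tau_inr_inr, pd_const,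
      hij, hji]

end Tau

/-! ### Expansions in a split orthonormal basis. -/

section Orthonormal

variable {E : Type*} [NormedAddCommGroup E] [InnerProductSpace ℝ E]
  {n r : ℕ} {e : Fin n → E} {N : Fin r → E}

theorem orthonormal_sum_elim (he : Orthonormal ℝ e) (hN : Orthonormal ℝ N)
    (heN : ∀ i k, ⟪e i, N k⟫_ℝ = 0) : Orthonormal ℝ (Sum.elim e N) := by
  classical
  rw [orthonormal_iff_ite]
  rintro (i | i) (j | j)
  · simpa using orthonormal_iff_ite.1 he i j
  · simpa using heN i j
  · simpa [real_inner_comm] using heN j i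
  · simpa using orthonormal_iff_ite.1 hN i j

variable [FiniteDimensional ℝ E]

theorem exists_orthonormalBasis_sum_elim (h : Orthonormal ℝ (Sum.elim e N))
    (hcard : Module.finrank ℝ E = n + r) :
    ∃ b : OrthonormalBasis (Fin n ⊕ Fin r) ℝ E, ⇑b = Sum.elim e N := by
  have hs := h.linearIndependent.span_eq_top_of_card_eq_finrank' (by simp [hcard])
  exact ⟨OrthonormalBasis.mk h hs.ge, OrthonormalBasis.coe_mk h _⟩

theorem eq_sum_inner_smul (h : Orthonormal ℝ (Sum.elim e N))
    (hcard : Module.finrank ℝ E = n + r) (u : E) :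
    u = ∑ i, ⟪e i, u⟫_ℝ • e i + ∑ k, ⟪N k, u⟫_ℝ • N k := by
  obtain ⟨b, hb⟩ := exists_orthonormalBasis_sum_elim h hcard
  conv_lhs => rw [← b.sum_repr' u, Fintype.sum_sum_type, hb]
  simp

theorem inner_eq_sum_inner_mul_inner (h : Orthonormal ℝ (Sum.elim e N))
    (hcard : Module.finrank ℝ E = n + r) (u v : E) :
    ⟪u, v⟫_ℝ = ∑ i, ⟪e i, u⟫_ℝ * ⟪e i, v⟫_ℝ + ∑ k, ⟪N k, u⟫_ℝ * ⟪N k, v⟫_ℝ := by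
  conv_lhs => rw [eq_sum_inner_smul h hcard u]
  simp [inner_add_left, sum_inner, real_inner_smul_left]

end Orthonormal

/-! ### Tangent and normal geometry of an immersion. -/

section Immersions

variable {n r : ℕ} {E : Type*} [NormedAddCommGroup E] [InnerProductSpace ℝ E]
  {X : Dom n → E} {x : Dom n}

theorem mem_tangentPlane (v : Dom n) : fderiv ℝ X x v ∈ tangentPlane X x :=
  LinearMap.mem_range_self _ v

theorem inner_fderiv_of_mem_normalPlane {ξ : E} (hξ : ξ ∈ normalPlane X x) (v : Dom n) :
    ⟪fderiv ℝ X x v, ξ⟫_ℝ = 0 :=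
  (Submodule.mem_orthogonal _ _).1 hξ _ (mem_tangentPlane v)

theorem mem_normalPlane_iff {ξ : E} :
    ξ ∈ normalPlane X x ↔ ∀ v, ⟪fderiv ℝ X x v, ξ⟫_ℝ = 0 := by
  refine ⟨fun h v => inner_fderiv_of_mem_normalPlane h v, fun h => ?_⟩
  refine (Submodule.mem_orthogonal _ _).2 fun u hu => ?_
  obtain ⟨v, rfl⟩ := hu
  exact h v

variable [FiniteDimensional ℝ E]

theorem normalPart_eq_zero_iff {u : E} : normalPart X x u = 0 ↔ u ∈ tangentPlane X x := by
  rw [normalPart, Submodule.starProjection_apply_eq_zero_iff, normalPlane,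
    Submodule.orthogonal_orthogonal]

theorem inner_normalPart_left {ξ : E} (hξ : ξ ∈ normalPlane X x) (u : E) :
    ⟪normalPart X x u, ξ⟫_ℝ = ⟪u, ξ⟫_ℝ := by
  rw [normalPart, Submodule.inner_starProjection_left_eq_right,
    Submodule.starProjection_eq_self_iff.2 hξ]

theorem normalPart_mem (u : E) : normalPart X x u ∈ normalPlane X x :=
  Submodule.starProjection_apply_mem _ u

theorem normalPart_of_mem {u : E} (hu : u ∈ normalPlane X x) : normalPart X x u = u :=
  Submodule.starProjection_eq_self_iff.2 hu

/-- The second fundamental form in the direction of a normal field. -/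
theorem inner_secondForm {O : Set (Dom n)} (hO : IsOpen O) (hx : x ∈ O)
    (hX : ContDiffOn ℝ ∞ X O) {N : Dom n → E} (hN : ContDiffOn ℝ ∞ N O)
    (hnormal : ∀ y ∈ O, N y ∈ normalPlane X y) (v w : Dom n) :
    ⟪secondForm X x v w, N x⟫_ℝ = ⟪fderiv ℝ X x w, fderiv ℝ N x v⟫_ℝ := by
  have hnhds := hO.mem_nhds hx
  have hX' : DifferentiableAt ℝ (fun y => fderiv ℝ X y w) x := by
    have h1 : ContDiffAt ℝ ∞ (fderiv ℝ X) x := (hX.contDiffAt hnhds).fderiv_right (by simp)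
    exact (h1.differentiableAt (by simp)).clm_apply (differentiableAt_const w)
  have hN' : DifferentiableAt ℝ N x := (hN.contDiffAt hnhds).differentiableAt (by simp)
  -- Differentiating ⟨dX(w), N⟩ = 0 moves the derivative from dX to N at the cost of a sign, which
  -- the sign in `secondForm` absorbs.
  have h0 : fderiv ℝ (fun y => ⟪fderiv ℝ X y w, N y⟫_ℝ) x v = 0 := by
    have : (fun y => ⟪fderiv ℝ X y w, N y⟫_ℝ) =ᶠ[nhds x] fun _ => (0 : ℝ) := by
      filter_upwards [hnhds] with y hy
      exact inner_fderiv_of_mem_normalPlane (hnormal y hy) w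
    rw [this.fderiv_eq]
    simp
  rw [fderiv_inner_apply ℝ hX' hN'] at h0
  rw [secondForm, inner_neg_left, inner_normalPart_left (hnormal x hx)]
  linarith

variable {e : Fin n → E} {N : Fin r → E} {c : Fin n → ℝ}

section AdaptedFrame

variable (hX : ∀ i, fderiv ℝ X x (EuclideanSpace.single i 1) = c i • e i)

include hX

omit [FiniteDimensional ℝ E] in
theorem fderiv_eq_sum_of_frame (v : Dom n) : fderiv ℝ X x v = ∑ i, (v i * c i) • e i := by
  rw [clm_apply_eq_sum]
  simp only [hX, smul_smul]

omit [FiniteDimensional ℝ E] in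
theorem firstForm_of_frame (he : Orthonormal ℝ e) (v w : Dom n) :
    firstForm X x v w = ∑ i, c i ^ 2 * (v i * w i) := by
  rw [firstForm, fderiv_eq_sum_of_frame hX, fderiv_eq_sum_of_frame hX, he.inner_sum]
  refine Finset.sum_congr rfl fun i _ => ?_
  simp
  ring

omit [FiniteDimensional ℝ E] in
theorem injective_fderiv_of_frame (he : Orthonormal ℝ e) (hc : ∀ i, c i ≠ 0) :
    Function.Injective (fderiv ℝ X x) := by
  refine (injective_iff_map_eq_zero _).2 fun v hv => ?_
  rw [fderiv_eq_sum_of_frame hX] at hv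
  ext i
  have := Fintype.linearIndependent_iff.1 he.linearIndependent _ hv i
  simpa [hc i] using this

omit [FiniteDimensional ℝ E] in
theorem tangentPlane_of_frame (hc : ∀ i, c i ≠ 0) :
    tangentPlane X x = Submodule.span ℝ (Set.range e) := by
  refine le_antisymm ?_ (Submodule.span_le.2 ?_)
  · rintro _ ⟨v, rfl⟩
    change fderiv ℝ X x v ∈ _
    rw [fderiv_eq_sum_of_frame hX]
    exact Submodule.sum_mem _ fun i _ =>
      Submodule.smul_mem _ _ (Submodule.subset_span ⟨i, rfl⟩)
  · rintro _ ⟨i, rfl⟩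
    have := (tangentPlane X x).smul_mem (c i)⁻¹ (mem_tangentPlane (X := X) (x := x)
      (EuclideanSpace.single i 1))
    rwa [hX, smul_smul, inv_mul_cancel₀ (hc i), one_smul] at this

omit [FiniteDimensional ℝ E] in
theorem mem_normalPlane_of_frame {ξ : E} (h : ∀ i, ⟪e i, ξ⟫_ℝ = 0) : ξ ∈ normalPlane X x := by
  rw [mem_normalPlane_iff]
  intro v
  rw [fderiv_eq_sum_of_frame hX, sum_inner]
  simp [real_inner_smul_left, h]

theorem normalPart_of_frame (hc : ∀ i, c i ≠ 0) (h : Orthonormal ℝ (Sum.elim e N))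
    (hcard : Module.finrank ℝ E = n + r) (u : E) :
    normalPart X x u = ∑ k, ⟪N k, u⟫_ℝ • N k := by
  have heN : ∀ i k, ⟪e i, N k⟫_ℝ = 0 := fun i k => by
    simpa using h.2 (i := Sum.inl i) (j := Sum.inr k) (by simp)
  refine Submodule.eq_starProjection_of_mem_orthogonal (K := normalPlane X x) ?_ ?_
  · exact Submodule.sum_mem _ fun k _ => Submodule.smul_mem _ _
      (mem_normalPlane_of_frame hX fun i => heN i k)
  · rw [normalPlane, Submodule.orthogonal_orthogonal, tangentPlane_of_frame hX hc]
    have : u - ∑ k, ⟪N k, u⟫_ℝ • N k = ∑ i, ⟪e i, u⟫_ℝ • e i := by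
      rw [sub_eq_iff_eq_add]
      exact eq_sum_inner_smul h hcard u
    rw [this]
    exact Submodule.sum_mem _ fun i _ => Submodule.smul_mem _ _ (Submodule.subset_span ⟨i, rfl⟩)

end AdaptedFrame

/-- An immersion with a parallel orthonormal frame spanning the normal spaces has flat normal
bundle. -/
theorem hasFlatNormalBundle_of_parallel_frame {N : Fin r → Dom n → E}
    (hN : IsParallelNormalFrame Set.univ X N)
    (hspan : ∀ y u, normalPart X y u = ∑ k, ⟪N k y, u⟫_ℝ • N k y) :
    HasFlatNormalBundle Set.univ X := by
  intro ξ hξ hnormal x _ v w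
  have hNs : ∀ k, ContDiff ℝ ∞ (N k) := fun k => contDiffOn_univ.1 (hN.smooth k)
  have hξs : ContDiff ℝ ∞ ξ := contDiffOn_univ.1 hξ
  have hNd : ∀ k, Differentiable ℝ (N k) := fun k => (hNs k).differentiable (by simp)
  -- In a parallel frame ∇^⊥ acts by differentiating the coefficients φ_k of ξ. Flatness thereby
  -- becomes the symmetry of their second derivatives.
  set φ : Fin r → Dom n → ℝ := fun k y => ⟪N k y, ξ y⟫_ℝ with hφ
  have hφs : ∀ k, ContDiff ℝ ∞ (φ k) := fun k => (hNs k).inner ℝ hξs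
  have htan : ∀ k y v, fderiv ℝ (N k) y v ∈ tangentPlane X y := fun k y v =>
    normalPart_eq_zero_iff.1 (hN.parallel k y (Set.mem_univ y) v)
  have htan' : ∀ k y v ξ, ξ ∈ normalPlane X y → ⟪fderiv ℝ (N k) y v, ξ⟫_ℝ = 0 :=
    fun k y v ξ hξ => (Submodule.mem_orthogonal _ _).1 hξ _ (htan k y v)
  have h1 : ∀ w, normalDeriv X ξ w = fun y => ∑ k, fderiv ℝ (φ k) y w • N k y := fun w => by
    funext y
    rw [normalDeriv, hspan]
    refine Finset.sum_congr rfl fun k _ => ?_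
    rw [hφ, fderiv_inner_apply ℝ (hNd k y) (hξs.differentiable (by simp) y),
      htan' k y w _ (hnormal y (Set.mem_univ y)), add_zero]
  have hφd : ∀ k w, DifferentiableAt ℝ (fun y => fderiv ℝ (φ k) y w) x := fun k w =>
    ((((hφs k).fderiv_right (m := ∞) (by simp)).differentiable (by simp)) x).clm_apply
      (differentiableAt_const w)
  have h2 : ∀ v w, normalDeriv X (normalDeriv X ξ w) v x =
      ∑ k, fderiv ℝ (fderiv ℝ (φ k)) x v w • N k x := fun v w => by
    rw [h1, normalDeriv, fderiv_fun_sum fun k _ => (hφd k w).fun_smul (hNd k x), sum_apply,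
      hspan]
    refine Finset.sum_congr rfl fun l _ => ?_
    congr 1
    rw [inner_sum, Finset.sum_eq_single l]
    · rw [fderiv_fun_smul (hφd l w) (hNd l x), fderiv_clm_apply
        (((hφs l).fderiv_right (m := ∞) (by simp)).differentiable (by simp) x)
        (differentiableAt_const w)]
      have hl : ‖N l x‖ = 1 := (hN.orthonormal x (Set.mem_univ x)).1 l
      have ht := htan' l x v _ (hN.normal l x (Set.mem_univ x))
      rw [real_inner_comm] at ht
      simp [inner_add_right, real_inner_smul_right, hl, ht]
    · intro k _ hkl
      rw [fderiv_fun_smul (hφd k w) (hNd k x)]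
      have hl : ⟪N l x, N k x⟫_ℝ = 0 := (hN.orthonormal x (Set.mem_univ x)).2 (Ne.symm hkl)
      have ht := htan' k x v _ (hN.normal l x (Set.mem_univ x))
      rw [real_inner_comm] at ht
      simp [inner_add_right, real_inner_smul_right, hl, ht]
    · simp
  rw [h2, h2]
  refine Finset.sum_congr rfl fun k _ => ?_
  have hφ2 : ContDiff ℝ 2 (φ k) := by exact_mod_cast contDiff_infty.1 (hφs k) 2
  rw [(hφ2.contDiffAt.isSymmSndFDerivAt (by simp)).eq]

/-- If d_k = ⟨N_k, ξ⟩, then A_ξ is diagonal with entries (Hᵗd)_i / c_i. Dividing by the nonzero c_i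
is injective, so the dimension is the rank of Hᵗ. -/
theorem finrank_shapeOperators {N : Fin r → E} (hN : Orthonormal ℝ N)
    (hnormal : ∀ k, N k ∈ normalPlane X x) {c : Fin n → ℝ} (hc : ∀ i, c i ≠ 0)
    {H : Matrix (Fin r) (Fin n) ℝ}
    (hI : ∀ v w, firstForm X x v w = ∑ i, c i ^ 2 * (v i * w i))
    (hII : ∀ v w, secondForm X x v w = ∑ i, ∑ k, (c i * H k i * (v i * w i)) • N k) :
    Module.finrank ℝ (shapeOperators X x) = H.rank := by
  set D : (Fin n → ℝ) →ₗ[ℝ] (Dom n →ₗ[ℝ] Dom n) :=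
    { toFun := fun a =>
        { toFun := fun v => WithLp.toLp 2 fun i => a i / c i * v i
          map_add' := fun v w => by ext i; simp [mul_add]
          map_smul' := fun t v => by ext i; simp; ring }
      map_add' := fun a b => by ext v i; simp [add_div, add_mul]
      map_smul' := fun t a => by ext v i; simp; ring } with hD
  have hDapp : ∀ a v i, D a v i = a i / c i * v i := fun a v i => rfl
  have hDinj : Function.Injective D := by
    refine (injective_iff_map_eq_zero _).2 fun a ha => ?_
    funext i
    have h1 : D a (EuclideanSpace.single i 1) i = 0 := by rw [ha]; rfl
    rw [hDapp] at h1
    simpa [hc i] using h1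
  have hinner : ∀ ξ v w, ⟪secondForm X x v w, ξ⟫_ℝ =
      ∑ i, c i * (Hᵀ *ᵥ fun k => ⟪N k, ξ⟫_ℝ) i * (v i * w i) := fun ξ v w => by
    rw [hII, sum_inner]
    refine Finset.sum_congr rfl fun i _ => ?_
    rw [sum_inner, Matrix.mulVec, dotProduct, Finset.mul_sum, Finset.sum_mul]
    refine Finset.sum_congr rfl fun k _ => ?_
    rw [real_inner_smul_left, Matrix.transpose_apply]
    ring
  -- The spanning set is already a linear subspace; every d is realised by the normal vector ∑ d_k
  -- N_k.
  have hset : {T : Dom n →ₗ[ℝ] Dom n | ∃ ξ ∈ normalPlane X x,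
      ∀ v w, firstForm X x (T v) w = ⟪secondForm X x v w, ξ⟫_ℝ} =
      LinearMap.range (D ∘ₗ Hᵀ.mulVecLin) := by
    ext T
    constructor
    · rintro ⟨ξ, hξ, hT⟩
      refine ⟨fun k => ⟪N k, ξ⟫_ℝ, ?_⟩
      ext v i
      have h := hT v (EuclideanSpace.single i 1)
      rw [hI, hinner] at h
      simp at h
      change D (Hᵀ *ᵥ fun k => ⟪N k, ξ⟫_ℝ) v i = _
      rw [hDapp]
      have := hc i
      have h2 : c i * (c i * (T v) i) = c i * ((Hᵀ *ᵥ fun k => ⟪N k, ξ⟫_ℝ) i * v i) := by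
        linarith
      have h3 := mul_left_cancel₀ this h2
      field_simp
      linarith
    · rintro ⟨d, rfl⟩
      refine ⟨∑ k, d k • N k, Submodule.sum_mem _ fun k _ => Submodule.smul_mem _ _ (hnormal k),
        fun v w => ?_⟩
      have hd : (fun k => ⟪N k, ∑ l, d l • N l⟫_ℝ) = d := funext fun k => by
        simpa using hN.inner_right_fintype d k
      rw [hI, hinner, hd]
      refine Finset.sum_congr rfl fun i _ => ?_
      change c i ^ 2 * (D (Hᵀ *ᵥ d) v i * w i) = _
      rw [hDapp]
      have := hc i
      field_simp
  rw [shapeOperators, hset, Submodule.span_eq, LinearMap.range_comp,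
    ← Matrix.rank_transpose, Matrix.rank]
  exact (Submodule.equivMapOfInjective D hDinj _).finrank_eq.symm

end Immersions

/-! ### Columns of matrix-valued maps as Euclidean maps. -/

section Columns

variable {n : ℕ} {ι κ : Type*} [Fintype ι] {M : Dom n → Matrix ι κ ℝ}

theorem contDiff_column (hM : MatSmoothOn Set.univ M) (j : κ) : ContDiff ℝ ∞ (column M j) :=
  contDiff_euclidean.2 fun a => contDiffOn_univ.1 (hM a j)

theorem fderiv_column_single (hM : MatSmoothOn Set.univ M) (j : κ) (i : Fin n) (x : Dom n)
    (a : ι) : fderiv ℝ (column M j) x (EuclideanSpace.single i 1) a = matPd i M x a j := by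
  have hd : DifferentiableAt ℝ (column M j) x := (contDiff_column hM j).differentiable (by simp) x
  exact (fderiv_clm_comp (EuclideanSpace.proj a : EuclideanSpace ℝ ι →L[ℝ] ℝ) hd _).symm

theorem orthonormal_column [DecidableEq ι] {A : Dom n → Matrix ι ι ℝ} {x : Dom n}
    (hA : A x ∈ Matrix.orthogonalGroup ι ℝ) : Orthonormal ℝ fun i => column A i x := by
  rw [orthonormal_iff_ite]
  intro i j
  have h := congrFun (congrFun ((Matrix.mem_orthogonalGroup_iff' ι ℝ).1 hA) j) i
  rw [Matrix.one_apply, Matrix.mul_apply] at h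
  simp only [Matrix.transpose_apply] at h
  rw [EuclideanSpace.inner_eq_star_dotProduct]
  simp only [column, dotProduct, Pi.star_apply, star_trivial, eq_comm (a := i)]
  exact h

end Columns

/-! ### From solutions of the system to tuples. -/

section Frames

variable {n r : ℕ} {F : Dom n → Matrix (Fin n) (Fin n) ℝ} {G : Dom n → Matrix (Fin r) (Fin n) ℝ}
  {B : Dom n → Matrix (Fin n) (Fin n) ℝ} {A : Dom n → Matrix (Fin n ⊕ Fin r) (Fin n ⊕ Fin r) ℝ}
  {X : Dom n → Matrix (Fin n ⊕ Fin r) (Fin n) ℝ}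

theorem inv_eq_transpose_of_mem_orthogonalGroup {ι : Type*} [Fintype ι] [DecidableEq ι]
    {M : Matrix ι ι ℝ} (hM : M ∈ Matrix.orthogonalGroup ι ℝ) : M⁻¹ = Mᵀ :=
  Matrix.inv_eq_right_inv ((Matrix.mem_orthogonalGroup_iff ι ℝ).1 hM)

theorem IsSolutionII.exists_isFrameII (h : IsSolutionII Set.univ F G B) :
    ∃ A, IsFrameII F G A := by
  obtain ⟨A, hs, ho, hd⟩ := h.isFlatConnection_tau.exists_orthogonal_frame
  refine ⟨A, hs, ho, fun i x => ?_⟩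
  rw [hd, inv_eq_transpose_of_mem_orthogonalGroup (ho x), ← mul_assoc,
    (Matrix.mem_orthogonalGroup_iff' _ ℝ).1 (ho x), one_mul]

theorem IsFrameII.matPd_eq (hA : IsFrameII F G A) (i : Fin n) (x : Dom n) :
    matPd i A x = A x * tau F G i x := by
  rw [← hA.2.2 i x, inv_eq_transpose_of_mem_orthogonalGroup (hA.2.1 x), ← mul_assoc,
    (Matrix.mem_orthogonalGroup_iff _ ℝ).1 (hA.2.1 x), one_mul]

/-- Column j of τ_i has a single nonzero entry when i ≠ j. The long derivative ∂_i e_i is never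
needed for closedness. -/
theorem IsFrameII.matPd_inl (hA : IsFrameII F G A) {i j : Fin n} (hij : i ≠ j) (x : Dom n)
    (a : Fin n ⊕ Fin r) :
    matPd i A x a (Sum.inl j) = A x a (Sum.inl i) * F x j i := by
  rw [hA.matPd_eq, Matrix.mul_apply, Fintype.sum_sum_type]
  simp [tau_inl_inl, tau_inr_inl, hij.symm]

theorem IsFrameII.matPd_inr (hA : IsFrameII F G A) (i : Fin n) (k : Fin r) (x : Dom n)
    (a : Fin n ⊕ Fin r) :
    matPd i A x a (Sum.inr k) = A x a (Sum.inl i) * G x k i := by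
  rw [hA.matPd_eq, Matrix.mul_apply, Fintype.sum_sum_type]
  simp [tau_inl_inr, tau_inr_inr]

theorem submatrix_mul_diagUnit_mul_apply (M : Matrix (Fin n ⊕ Fin r) (Fin n ⊕ Fin r) ℝ)
    (N : Matrix (Fin n) (Fin n) ℝ) (i : Fin n) (a : Fin n ⊕ Fin r) (j : Fin n) :
    (M.submatrix id Sum.inl * diagUnit i * Nᵀ) a j = M a (Sum.inl i) * N j i := by
  rw [Matrix.mul_apply]
  simp [mul_diagUnit_apply]

theorem IsFrameII.exists_isPrimitiveII (h : IsSolutionII Set.univ F G B)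
    (hA : IsFrameII F G A) : ∃ X, IsPrimitiveII A B X := by
  have hAs : ∀ a b, ContDiff ℝ ∞ fun y => A y a b := fun a b => contDiffOn_univ.1 (hA.1 a b)
  have hBs : ∀ a b, ContDiff ℝ ∞ fun y => B y a b := fun a b =>
    contDiffOn_univ.1 (h.smooth_B a b)
  have hp : ∀ a j, ∃ f : Dom n → ℝ, ContDiff ℝ ∞ f ∧
      ∀ i x, pd i f x = -(A x a (Sum.inl i) * B x j i) := fun a j => by
    refine exists_pd_eq_of_closed (fun i => ((hAs _ _).mul (hBs _ _)).neg) fun i k x => ?_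
    by_cases hik : i = k
    · rw [hik]
    -- By the frame equation and the equation for B, ∂_i(b_{jk} e_k) = f_{ki} b_{jk} e_i + f_{ik}
    -- b_{ji} e_k, which is symmetric in i and k.
    have hd : ∀ i k, i ≠ k → pd i (fun y => -(A y a (Sum.inl k) * B y j k)) x =
        -(A x a (Sum.inl i) * F x k i * B x j k + A x a (Sum.inl k) * (F x i k * B x j i)) :=
      fun i k hik => by
        rw [pd_neg, pd_mul ((hAs _ _).differentiable (by simp) x)
          ((hBs _ _).differentiable (by simp) x), h.eq_B x (Set.mem_univ x) j k i hik.symm]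
        congr 3
        exact hA.matPd_inl hik x a
    rw [hd i k hik, hd k i (Ne.symm hik)]
    ring
  choose f hfs hf using hp
  refine ⟨fun x => Matrix.of fun a j => f a j x, fun a j => (hfs a j).contDiffOn,
    fun i x => ?_⟩
  ext a j
  rw [Matrix.neg_apply, submatrix_mul_diagUnit_mul_apply]
  exact hf a j i x

theorem IsPrimitiveII.fderiv_column_single (hX : IsPrimitiveII A B X) (j i : Fin n) (x : Dom n) :
    fderiv ℝ (column X j) x (EuclideanSpace.single i 1) =
      (-B x j i) • column A (Sum.inl i) x := by
  ext a
  rw [GSystem.fderiv_column_single hX.1, hX.2, Matrix.neg_apply,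
    submatrix_mul_diagUnit_mul_apply]
  simp [column, mul_comm]

theorem IsFrameII.fderiv_column_inr (hA : IsFrameII F G A) (k : Fin r) (x v : Dom n) :
    fderiv ℝ (column A (Sum.inr k)) x v =
      ∑ i, (v i * G x k i) • column A (Sum.inl i) x := by
  -- The normal column is itself a map adapted to the frame e, with the entries of row k of G as
  -- coefficients.
  refine fderiv_eq_sum_of_frame (fun i => ?_) v
  ext a
  rw [GSystem.fderiv_column_single hA.1, hA.matPd_inr]
  simp [column, mul_comm]

variable (hA : IsFrameII F G A) (hX : IsPrimitiveII A B X) (hB : ∀ x i j, B x i j ≠ 0)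

theorem IsFrameII.orthonormal (hA : IsFrameII F G A) (x : Dom n) :
    Orthonormal ℝ (Sum.elim (fun i : Fin n => column A (Sum.inl i) x)
      fun k : Fin r => column A (Sum.inr k) x) := by
  convert orthonormal_column (hA.2.1 x) with i
  cases i <;> rfl

theorem IsFrameII.orthonormal_inl (hA : IsFrameII F G A) (x : Dom n) :
    Orthonormal ℝ fun i : Fin n => column A (Sum.inl i) x :=
  (orthonormal_column (hA.2.1 x)).comp Sum.inl Sum.inl_injective

theorem finrank_amb (n r : ℕ) : Module.finrank ℝ (Amb n r) = n + r := by simp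

include hA hX in
theorem IsPrimitiveII.firstForm_eq (j : Fin n) (x v w : Dom n) :
    firstForm (column X j) x v w = ∑ i, B x j i ^ 2 * (v i * w i) := by
  rw [firstForm_of_frame (hX.fderiv_column_single j · x)
    (hA.orthonormal_inl x)]
  simp

include hX hB in
theorem IsPrimitiveII.tangentPlane_eq (j : Fin n) (x : Dom n) :
    tangentPlane (column X j) x =
      Submodule.span ℝ (Set.range fun i : Fin n => column A (Sum.inl i) x) :=
  tangentPlane_of_frame (hX.fderiv_column_single j · x) fun i => neg_ne_zero.2 (hB x j i)

include hA hX hB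

theorem IsPrimitiveII.normalPart_eq (j : Fin n) (x : Dom n) (u : Amb n r) :
    normalPart (column X j) x u =
      ∑ k, ⟪column A (Sum.inr k) x, u⟫_ℝ • column A (Sum.inr k) x :=
  normalPart_of_frame (hX.fderiv_column_single j · x) (fun i => neg_ne_zero.2 (hB x j i))
    (hA.orthonormal x) (finrank_amb n r) u

theorem IsPrimitiveII.isParallelNormalFrame (j : Fin n) :
    IsParallelNormalFrame Set.univ (column X j) fun k : Fin r => column A (Sum.inr k) where
  smooth k := (contDiff_column hA.1 (Sum.inr k)).contDiffOn
  orthonormal x _ := (orthonormal_column (hA.2.1 x)).comp Sum.inr Sum.inr_injective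
  normal k x _ := mem_normalPlane_of_frame (hX.fderiv_column_single j · x) fun i =>
    (orthonormal_column (hA.2.1 x)).2 (i := Sum.inl i) (j := Sum.inr k) (by simp)
  parallel k x _ v := by
    rw [normalDeriv, normalPart_eq_zero_iff, hA.fderiv_column_inr, hX.tangentPlane_eq hB]
    exact Submodule.sum_mem _ fun i _ => Submodule.smul_mem _ _ (Submodule.subset_span ⟨i, rfl⟩)

theorem IsPrimitiveII.secondForm_eq (j : Fin n) (x v w : Dom n) :
    secondForm (column X j) x v w =
      -∑ i, ∑ k, (G x k i * B x j i * (v i * w i)) • column A (Sum.inr k) x := by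
  have hN := hX.isParallelNormalFrame hA hB j
  have hmem : secondForm (column X j) x v w ∈ normalPlane (column X j) x :=
    Submodule.neg_mem _ (normalPart_mem _)
  rw [← normalPart_of_mem hmem, hX.normalPart_eq hA hB, Finset.sum_comm,
    ← Finset.sum_neg_distrib]
  refine Finset.sum_congr rfl fun k _ => ?_
  rw [real_inner_comm, inner_secondForm isOpen_univ (Set.mem_univ x)
    (contDiff_column hX.1 j).contDiffOn (hN.smooth k) (hN.normal k),
    fderiv_eq_sum_of_frame (hX.fderiv_column_single j · x), hA.fderiv_column_inr,
    (hA.orthonormal_inl x).inner_sum, ← Finset.sum_smul, ← neg_smul,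
    ← Finset.sum_neg_distrib]
  congr 1
  refine Finset.sum_congr rfl fun i _ => ?_
  simp
  ring

/-- The coefficient map is -G because dX carries a minus sign, whereas the forms of a tuple are
written with a plus. -/
theorem IsPrimitiveII.isTupleTypeOWith (h : IsSolutionII Set.univ F G B) :
    IsTupleTypeOWith Set.univ (column X) (fun k : Fin r => column A (Sum.inr k)) B
      (fun x => -G x) where
  immersion j := ⟨(contDiff_column hX.1 j).contDiffOn, fun x _ =>
    injective_fderiv_of_frame (hX.fderiv_column_single j · x)
      (hA.orthonormal_inl x) fun i => neg_ne_zero.2 (hB x j i)⟩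
  flat j := hasFlatNormalBundle_of_parallel_frame (hX.isParallelNormalFrame hA hB j)
    (hX.normalPart_eq hA hB j)
  normal_parallel i j x _ := by
    rw [normalPlane, normalPlane, hX.tangentPlane_eq hB, hX.tangentPlane_eq hB]
  frame j := hX.isParallelNormalFrame hA hB j
  smooth_B := h.smooth_B
  smooth_G a b := (h.smooth_G a b).neg
  orth_B := h.orth_B
  first_form j x _ v w := hX.firstForm_eq hA j x v w
  second_form j x _ v w := by
    rw [hX.secondForm_eq hA hB]
    simp only [← Finset.sum_neg_distrib, ← neg_smul, Matrix.neg_apply]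
    refine Finset.sum_congr rfl fun i _ => Finset.sum_congr rfl fun k _ => ?_
    congr 1
    ring

theorem IsPrimitiveII.hasNondegenerateNormalBundle_iff (j : Fin n) :
    HasNondegenerateNormalBundle Set.univ (column X j) ↔ ∀ x, (G x).rank = n := by
  have hN := hX.isParallelNormalFrame hA hB j
  have : ∀ x, Module.finrank ℝ (shapeOperators (column X j) x) = (G x).rank := fun x => by
    -- Taking c_i = -b_{ji} puts the sign into c, so that H is G itself.
    refine finrank_shapeOperators (hN.orthonormal x (Set.mem_univ x))
      (fun k => hN.normal k x (Set.mem_univ x)) (fun i => neg_ne_zero.2 (hB x j i))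
      (fun v w => ?_) fun v w => ?_
    · simp [hX.firstForm_eq hA]
    · rw [hX.secondForm_eq hA hB]
      simp only [← Finset.sum_neg_distrib, ← neg_smul]
      refine Finset.sum_congr rfl fun i _ => Finset.sum_congr rfl fun k _ => ?_
      congr 1
      ring
  simp [HasNondegenerateNormalBundle, this]

end Frames

/-! ### Partial derivatives of vector-valued maps on an open set. -/

section PartialDerivatives

variable {n : ℕ} {V : Type*} [NormedAddCommGroup V] [NormedSpace ℝ V] {O : Set (Dom n)}
  {f g : Dom n → V} {x : Dom n}

/-- The partial derivative `∂f/∂xᵢ` of a vector-valued map. -/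
def vecPd (i : Fin n) (f : Dom n → V) (x : Dom n) : V := fderiv ℝ f x (EuclideanSpace.single i 1)

theorem pd_eq_vecPd (i : Fin n) (f : Dom n → ℝ) : pd i f = vecPd i f := rfl

theorem contDiffOn_vecPd (hO : IsOpen O) (hf : ContDiffOn ℝ ∞ f O) (i : Fin n) :
    ContDiffOn ℝ ∞ (vecPd i f) O :=
  (hf.fderiv_of_isOpen hO (by simp)).clm_apply contDiffOn_const

theorem differentiableAt_of_contDiffOn (hO : IsOpen O) (hf : ContDiffOn ℝ ∞ f O) (hx : x ∈ O) :
    DifferentiableAt ℝ f x :=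
  (hf.contDiffAt (hO.mem_nhds hx)).differentiableAt (by simp)

theorem vecPd_congr (hO : IsOpen O) (h : Set.EqOn f g O) (hx : x ∈ O) (i : Fin n) :
    vecPd i f x = vecPd i g x := by
  rw [vecPd, (Filter.eventuallyEq_of_mem (hO.mem_nhds hx) h).fderiv_eq, vecPd]

theorem vecPd_comm (hO : IsOpen O) (hf : ContDiffOn ℝ ∞ f O) (hx : x ∈ O) (i j : Fin n) :
    vecPd i (vecPd j f) x = vecPd j (vecPd i f) x := by
  have hf2 : ContDiffAt ℝ 2 f x := by
    exact_mod_cast contDiffAt_infty.1 (hf.contDiffAt (hO.mem_nhds hx)) 2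
  have hd : DifferentiableAt ℝ (fderiv ℝ f) x :=
    differentiableAt_of_contDiffOn hO (hf.fderiv_of_isOpen hO (by simp)) hx
  have h : ∀ i j, vecPd i (vecPd j f) x =
      fderiv ℝ (fderiv ℝ f) x (EuclideanSpace.single i 1) (EuclideanSpace.single j 1) :=
    fun i j => by
      change fderiv ℝ (fun y => fderiv ℝ f y (EuclideanSpace.single j 1)) x _ = _
      rw [fderiv_clm_apply hd (differentiableAt_const _)]
      simp
  rw [h, h, (hf2.isSymmSndFDerivAt (by simp)).eq]

theorem vecPd_smul {c : Dom n → ℝ} (hc : DifferentiableAt ℝ c x) (hf : DifferentiableAt ℝ f x)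
    (i : Fin n) : vecPd i (fun y => c y • f y) x = pd i c x • f x + c x • vecPd i f x := by
  rw [vecPd, fderiv_fun_smul hc hf, add_comm]
  rfl

theorem pd_inner {W : Type*} [NormedAddCommGroup W] [InnerProductSpace ℝ W] {f g : Dom n → W}
    (hf : DifferentiableAt ℝ f x) (hg : DifferentiableAt ℝ g x) (i : Fin n) :
    pd i (fun y => ⟪f y, g y⟫_ℝ) x = ⟪vecPd i f x, g x⟫_ℝ + ⟪f x, vecPd i g x⟫_ℝ := by
  rw [pd, fderiv_inner_apply ℝ hf hg, add_comm]
  rfl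

end PartialDerivatives

/-! ### Compatibility conditions for maps adapted to a moving frame. -/

section MovingFrame

variable {n r : ℕ} {V : Type*} [NormedAddCommGroup V] [InnerProductSpace ℝ V] {O : Set (Dom n)}
  {E : Fin n → Dom n → V} {N : Fin r → Dom n → V} {G : Dom n → Matrix (Fin r) (Fin n) ℝ}
  {x : Dom n}

theorem inner_vecPd_add_of_const {f g : Dom n → V} {c : ℝ} (hO : IsOpen O)
    (hf : ContDiffOn ℝ ∞ f O) (hg : ContDiffOn ℝ ∞ g O) (h : ∀ y ∈ O, ⟪f y, g y⟫_ℝ = c)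
    (hx : x ∈ O) (i : Fin n) : ⟪vecPd i f x, g x⟫_ℝ + ⟪f x, vecPd i g x⟫_ℝ = 0 := by
  rw [← pd_inner (differentiableAt_of_contDiffOn hO hf hx)
    (differentiableAt_of_contDiffOn hO hg hx), pd_eq_vecPd,
    vecPd_congr (f := fun y => ⟪f y, g y⟫_ℝ) (g := fun _ => c) hO h hx]
  exact pd_const i c

/-- Both sides are the mixed second derivative of Y; all compatibility conditions below are
components of this identity. -/
theorem pd_coeff_eq {Y e₁ e₂ : Dom n → V} {c₁ c₂ : Dom n → ℝ} {i k : Fin n} (hO : IsOpen O)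
    (hY : ContDiffOn ℝ ∞ Y O) (he₁ : ContDiffOn ℝ ∞ e₁ O) (he₂ : ContDiffOn ℝ ∞ e₂ O)
    (hc₁ : ContDiffOn ℝ ∞ c₁ O) (hc₂ : ContDiffOn ℝ ∞ c₂ O)
    (hi : ∀ y ∈ O, vecPd i Y y = c₁ y • e₁ y) (hk : ∀ y ∈ O, vecPd k Y y = c₂ y • e₂ y)
    (hx : x ∈ O) :
    pd k c₁ x • e₁ x + c₁ x • vecPd k e₁ x = pd i c₂ x • e₂ x + c₂ x • vecPd i e₂ x := by
  have h := vecPd_comm hO hY hx k i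
  rw [vecPd_congr hO hi hx, vecPd_congr hO hk hx,
    vecPd_smul (differentiableAt_of_contDiffOn hO hc₁ hx)
      (differentiableAt_of_contDiffOn hO he₁ hx),
    vecPd_smul (differentiableAt_of_contDiffOn hO hc₂ hx)
      (differentiableAt_of_contDiffOn hO he₂ hx)] at h
  exact h

variable (hO : IsOpen O) (hE : ∀ i, ContDiffOn ℝ ∞ (E i) O)
  (horth : ∀ y ∈ O, Orthonormal ℝ fun i => E i y)

include hO hE horth

theorem inner_frame_vecPd_self (hx : x ∈ O) (i k : Fin n) : ⟪E i x, vecPd k (E i) x⟫_ℝ = 0 := by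
  have h := inner_vecPd_add_of_const (c := 1) hO (hE i) (hE i)
    (fun y hy => by rw [real_inner_self_eq_norm_sq, (horth y hy).1 i, one_pow]) hx k
  rw [real_inner_comm] at h
  linarith

theorem inner_vecPd_frame_eq_neg (hx : x ∈ O) {i j : Fin n} (hij : i ≠ j) (k : Fin n) :
    ⟪E i x, vecPd k (E j) x⟫_ℝ = -⟪E j x, vecPd k (E i) x⟫_ℝ := by
  have h := inner_vecPd_add_of_const (c := 0) hO (hE i) (hE j)
    (fun y hy => (horth y hy).2 hij) hx k
  rw [real_inner_comm] at h
  linarith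

/-- If `∂Y/∂xᵢ = c₁ eᵢ` and `∂Y/∂xₖ = c₂ eₖ`, then `∂c₁/∂xₖ = c₂ ⟨eᵢ, ∂eₖ/∂xᵢ⟩`. -/
theorem pd_coeff_eq_mul_inner {Y : Dom n → V} {c₁ c₂ : Dom n → ℝ} {i k : Fin n} (hik : i ≠ k)
    (hY : ContDiffOn ℝ ∞ Y O) (hc₁ : ContDiffOn ℝ ∞ c₁ O) (hc₂ : ContDiffOn ℝ ∞ c₂ O)
    (hi : ∀ y ∈ O, vecPd i Y y = c₁ y • E i y) (hk : ∀ y ∈ O, vecPd k Y y = c₂ y • E k y)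
    (hx : x ∈ O) : pd k c₁ x = c₂ x * ⟪E i x, vecPd i (E k) x⟫_ℝ := by
  have h := congrArg (⟪E i x, ·⟫_ℝ)
    (pd_coeff_eq hO hY (hE i) (hE k) hc₁ hc₂ hi hk hx)
  simp only [inner_add_right, real_inner_smul_right, (horth x hx).2 hik,
    inner_frame_vecPd_self hO hE horth hx, real_inner_self_eq_norm_sq, (horth x hx).1 i] at h
  linarith

/-- Along a third frame vector the derivatives of the coefficients drop out, leaving a linear
relation between two connection coefficients that do not involve Y. -/
theorem coeff_mul_inner_comm {Y : Dom n → V} {c₁ c₂ : Dom n → ℝ} {a i k : Fin n} (hai : a ≠ i)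
    (hak : a ≠ k)
    (hY : ContDiffOn ℝ ∞ Y O) (hc₁ : ContDiffOn ℝ ∞ c₁ O) (hc₂ : ContDiffOn ℝ ∞ c₂ O)
    (hi : ∀ y ∈ O, vecPd i Y y = c₁ y • E i y) (hk : ∀ y ∈ O, vecPd k Y y = c₂ y • E k y)
    (hx : x ∈ O) :
    c₁ x * ⟪E a x, vecPd k (E i) x⟫_ℝ = c₂ x * ⟪E a x, vecPd i (E k) x⟫_ℝ := by
  have h := congrArg (⟪E a x, ·⟫_ℝ)
    (pd_coeff_eq hO hY (hE i) (hE k) hc₁ hc₂ hi hk hx)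
  simp only [inner_add_right, real_inner_smul_right, (horth x hx).2 hai,
    (horth x hx).2 hak] at h
  linarith

end MovingFrame

/-! ### The system as structure equations of a common frame. -/

section MovingFrameSystem

variable {n r : ℕ} {V : Type*} [NormedAddCommGroup V] [InnerProductSpace ℝ V]
  [FiniteDimensional ℝ V] {O : Set (Dom n)}
  {E : Fin n → Dom n → V} {N : Fin r → Dom n → V} {X : Fin n → Dom n → V}
  {B : Dom n → Matrix (Fin n) (Fin n) ℝ} {G : Dom n → Matrix (Fin r) (Fin n) ℝ}

theorem sum_mul_eq_of_mem_orthogonalGroup {M : Matrix (Fin n) (Fin n) ℝ}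
    (hM : M ∈ Matrix.orthogonalGroup (Fin n) ℝ) (i k : Fin n) :
    ∑ j, M j i * M j k = if i = k then 1 else 0 := by
  have h := congrFun (congrFun ((Matrix.mem_orthogonalGroup_iff' _ ℝ).1 hM) i) k
  rwa [Matrix.one_apply, Matrix.mul_apply] at h

/-- If the maps `X_j` and the normal fields `N_k` satisfy `∂X_j/∂xᵢ = b_{ji} eᵢ` and
`∂N_k/∂xᵢ = g_{ki} eᵢ` for a common orthonormal moving frame, the coefficients solve the
`G_{m,n}`-system II. -/
theorem isSolutionII_of_movingFrame (hO : IsOpen O) (hcard : Module.finrank ℝ V = n + r)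
    (hE : ∀ i, ContDiffOn ℝ ∞ (E i) O) (hN : ∀ k, ContDiffOn ℝ ∞ (N k) O)
    (hX : ∀ j, ContDiffOn ℝ ∞ (X j) O) (hB : MatSmoothOn O B) (hG : MatSmoothOn O G)
    (horth : ∀ y ∈ O, Orthonormal ℝ (Sum.elim (fun i => E i y) fun k => N k y))
    (hBorth : ∀ y ∈ O, B y ∈ Matrix.orthogonalGroup (Fin n) ℝ)
    (hBne : ∀ y ∈ O, ∀ i j, B y i j ≠ 0)
    (hXE : ∀ j i, ∀ y ∈ O, vecPd i (X j) y = B y j i • E i y)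
    (hNE : ∀ k i, ∀ y ∈ O, vecPd i (N k) y = G y k i • E i y) (l : Fin n) :
    IsSolutionII O (rowF B l) G B := by
  have hEo : ∀ y ∈ O, Orthonormal ℝ fun i => E i y := fun y hy =>
    (horth y hy).comp Sum.inl Sum.inl_injective
  have hEN : ∀ y ∈ O, ∀ i k, ⟪E i y, N k y⟫_ℝ = 0 := fun y hy i k =>
    (horth y hy).2 (i := Sum.inl i) (j := Sum.inr k) (by simp)
  have hpdB : ∀ y ∈ O, ∀ i j k, j ≠ k →
      pd k (fun z => B z i j) y = B y i k * ⟪E j y, vecPd j (E k) y⟫_ℝ := fun y hy i j k hjk =>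
    pd_coeff_eq_mul_inner hO hE hEo hjk (hX i) (hB i j) (hB i k) (hXE i j) (hXE i k) hy
  -- The quotient defining f_{ij} is a connection coefficient of the frame, hence independent of the
  -- chosen row l.
  have hF : ∀ y ∈ O, ∀ i j, i ≠ j → rowF B l y i j = ⟪E j y, vecPd j (E i) y⟫_ℝ :=
    fun y hy i j hij => by
      rw [rowF, Matrix.of_apply, if_neg hij, hpdB y hy l j i (Ne.symm hij),
        mul_div_cancel_left₀ _ (hBne y hy l i)]
  have hF0 : ∀ y i, rowF B l y i i = 0 := fun y i => by simp [rowF]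
  have hFs : MatSmoothOn O (rowF B l) := fun i j => by
    by_cases hij : i = j
    · simp only [hij, hF0]
      exact contDiffOn_const
    · simp only [rowF, Matrix.of_apply, if_neg hij]
      exact (contDiffOn_vecPd hO (hB l j) i).div (hB l i) fun y hy => hBne y hy l i
  have hdE : ∀ y ∈ O, ∀ i k, i ≠ k → vecPd k (E i) y = rowF B l y i k • E k y :=
    fun y hy i k hik => by
      have hzero : ∀ a, a ≠ k → ⟪E a y, vecPd k (E i) y⟫_ℝ = 0 := fun a hak => by
        by_cases hai : a = i
        · rw [hai]
          exact inner_frame_vecPd_self hO hE hEo hy i k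
        -- Here all n maps are needed: b_{ji} u = b_{jk} w holds for every j with u and w
        -- independent of j. Multiplying by b_{ji} and summing gives u = 0, as columns i and k of B
        -- are orthonormal.
        have hrow : ∀ j, B y j i * ⟪E a y, vecPd k (E i) y⟫_ℝ =
            B y j k * ⟪E a y, vecPd i (E k) y⟫_ℝ := fun j =>
          coeff_mul_inner_comm hO hE hEo hai hak (hX j) (hB j i) (hB j k) (hXE j i) (hXE j k) hy
        have hii := sum_mul_eq_of_mem_orthogonalGroup (hBorth y hy) i i
        have hik' := sum_mul_eq_of_mem_orthogonalGroup (hBorth y hy) i k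
        rw [if_pos rfl] at hii
        rw [if_neg hik] at hik'
        calc ⟪E a y, vecPd k (E i) y⟫_ℝ
            = ∑ j, B y j i * (B y j i * ⟪E a y, vecPd k (E i) y⟫_ℝ) := by
              simp only [← mul_assoc, ← Finset.sum_mul, hii, one_mul]
          _ = 0 := by
              simp only [hrow, ← mul_assoc, ← Finset.sum_mul, hik', zero_mul]
      have hnormal : ∀ α, ⟪N α y, vecPd k (E i) y⟫_ℝ = 0 := fun α => by
        have h := inner_vecPd_add_of_const (c := 0) hO (hE i) (hN α)
          (fun z hz => hEN z hz i α) hy k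
        rw [hNE α k y hy, real_inner_smul_right, (hEo y hy).2 hik, mul_zero, add_zero,
          real_inner_comm] at h
        exact h
      rw [eq_sum_inner_smul (horth y hy) hcard (vecPd k (E i) y)]
      simp only [hnormal, zero_smul, Finset.sum_const_zero, add_zero]
      rw [Finset.sum_eq_single k (fun a _ hak => by rw [hzero a hak, zero_smul]) (by simp),
        hF y hy i k hik]
  refine ⟨hFs, hG, hB, fun y _ => hF0 y, hBorth, fun x hx i j hij => ?_,
    fun x hx i j k hij hjk hik => ?_, fun x hx i j k hjk => ?_, fun x hx α j k hjk => ?_⟩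
  · have hEd : ∀ i, DifferentiableAt ℝ (E i) x := fun i =>
      differentiableAt_of_contDiffOn hO (hE i) hx
    have hdEd : ∀ i k, DifferentiableAt ℝ (vecPd k (E i)) x := fun i k =>
      differentiableAt_of_contDiffOn hO (contDiffOn_vecPd hO (hE i) k) hx
    have h1 : pd i (fun y => rowF B l y i j) x = ⟪E j x, vecPd j (vecPd i (E i)) x⟫_ℝ := by
      rw [vecPd_comm hO (hE i) hx, vecPd_congr hO (fun y hy => hdE y hy i j hij) hx,
        vecPd_smul (differentiableAt_of_contDiffOn hO (hFs i j) hx) (hEd j),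
        inner_add_right, real_inner_smul_right, real_inner_smul_right,
        real_inner_self_eq_norm_sq, (hEo x hx).1 j, inner_frame_vecPd_self hO hE hEo hx]
      ring
    -- Using f_{ji} = -⟨E_j, ∂_i E_i⟩, the third-order-looking terms of the two derivatives cancel
    -- and leave -⟨∂_j E_j, ∂_i E_i⟩, whose expansion in the full frame is the Gauss equation.
    have h2 : pd j (fun y => rowF B l y j i) x =
        -(⟪vecPd j (E j) x, vecPd i (E i) x⟫_ℝ + ⟪E j x, vecPd j (vecPd i (E i)) x⟫_ℝ) := by
      rw [← pd_inner (hEd j) (hdEd i i), ← pd_neg, pd_eq_vecPd]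
      refine vecPd_congr hO (fun y hy => ?_) hx j
      rw [hF y hy j i hij.symm, inner_vecPd_frame_eq_neg hO hE hEo hy hij]
    have hin : ∀ a i, ⟪E a x, vecPd i (E i) x⟫_ℝ = -rowF B l x a i := fun a i => by
      by_cases hai : a = i
      · rw [hai, hF0, inner_frame_vecPd_self hO hE hEo hx, neg_zero]
      · rw [hF x hx a i hai, inner_vecPd_frame_eq_neg hO hE hEo hx hai]
    have hinN : ∀ α i, ⟪N α x, vecPd i (E i) x⟫_ℝ = -G x α i := fun α i => by
      have h := inner_vecPd_add_of_const (c := 0) hO (hE i) (hN α)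
        (fun z hz => hEN z hz i α) hx i
      rw [hNE α i x hx, real_inner_smul_right, real_inner_self_eq_norm_sq, (hEo x hx).1 i,
        real_inner_comm] at h
      linarith
    have hsE : ∑ a, ⟪E a x, vecPd j (E j) x⟫_ℝ * ⟪E a x, vecPd i (E i) x⟫_ℝ =
        ∑ a, rowF B l x a i * rowF B l x a j :=
      Finset.sum_congr rfl fun a _ => by rw [hin, hin, neg_mul_neg, mul_comm]
    have hsN : ∑ α, ⟪N α x, vecPd j (E j) x⟫_ℝ * ⟪N α x, vecPd i (E i) x⟫_ℝ =
        ∑ α, G x α i * G x α j :=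
      Finset.sum_congr rfl fun α _ => by rw [hinN, hinN, neg_mul_neg, mul_comm]
    rw [h1, h2, inner_eq_sum_inner_mul_inner (horth x hx) hcard (vecPd j (E j) x), hsE, hsN]
    ring
  -- The same compatibility lemma applied to E_i, X_i and N_α gives the equations for F, B and G.
  · have h := pd_coeff_eq_mul_inner hO hE hEo hjk (hE i) (hFs i j) (hFs i k)
      (fun y hy => hdE y hy i j hij) (fun y hy => hdE y hy i k hik) hx
    rw [h, hF x hx k j hjk.symm]
  · rw [hpdB x hx i j k hjk, hF x hx k j hjk.symm, mul_comm]
  · rw [hF x hx k j hjk.symm, mul_comm]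
    exact pd_coeff_eq_mul_inner hO hE hEo hjk (hN α) (hG α j) (hG α k) (hNE α j) (hNE α k) hx

end MovingFrameSystem

/-! ### From tuples to a common moving frame. -/

section Tuples

variable {n r : ℕ} {O : Set (Dom n)} {X : Fin n → Dom n → Amb n r} {e : Fin r → Dom n → Amb n r}
  {B : Dom n → Matrix (Fin n) (Fin n) ℝ} {G : Dom n → Matrix (Fin r) (Fin n) ℝ} {x : Dom n}

theorem IsTupleTypeOWith.inner_vecPd (h : IsTupleTypeOWith O X e B G) (hx : x ∈ O)
    (j i k : Fin n) :
    ⟪vecPd i (X j) x, vecPd k (X j) x⟫_ℝ = if i = k then B x j i ^ 2 else 0 := by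
  have := h.first_form j x hx (EuclideanSpace.single i 1) (EuclideanSpace.single k 1)
  rw [vecPd, vecPd]
  refine this.trans ?_
  rw [Finset.sum_eq_single i]
  · by_cases hik : i = k <;> simp [hik]
  · intro a _ hai
    simp [hai]
  · simp

/-- The length of ∂_i X_j is |b_{ji}|, so a zero would contradict the immersion property. -/
theorem IsTupleTypeOWith.ne_zero (h : IsTupleTypeOWith O X e B G) (hx : x ∈ O) (j i : Fin n) :
    B x j i ≠ 0 := fun h0 => by
  have h1 := h.inner_vecPd hx j i i
  rw [if_pos rfl, h0, zero_pow two_ne_zero, inner_self_eq_zero] at h1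
  have h2 := (h.immersion j).2 x hx (h1.trans (map_zero _).symm)
  simpa using congrArg (fun v : Dom n => v i) h2

/-- The difference of the two sides is tangent because the normal is parallel, and orthogonal to
every ∂_l X_j by the second fundamental form. The left side is free of j, which ties the different
X_j together. -/
theorem IsTupleTypeOWith.vecPd_normal (h : IsTupleTypeOWith O X e B G) (hO : IsOpen O)
    (hx : x ∈ O) (j : Fin n) (k : Fin r) (i : Fin n) :
    vecPd i (e k) x = (G x k i / B x j i) • vecPd i (X j) x := by
  have hframe := h.frame j
  rw [← sub_eq_zero, ← inner_self_eq_zero (𝕜 := ℝ)]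
  set u := vecPd i (e k) x - (G x k i / B x j i) • vecPd i (X j) x with hu
  have htan : u ∈ tangentPlane (X j) x :=
    Submodule.sub_mem _ (normalPart_eq_zero_iff.1 (hframe.parallel k x hx _))
      (Submodule.smul_mem _ _ (mem_tangentPlane _))
  refine (Submodule.mem_orthogonal _ _).1 (?_ : u ∈ normalPlane (X j) x) u htan
  -- This criterion needs no orthonormality, so the coordinate vectors themselves serve as the
  -- frame.
  refine mem_normalPlane_of_frame (e := fun l => vecPd l (X j) x) (c := fun _ => 1)
    (fun l => (one_smul ℝ _).symm) fun l => ?_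
  have hII := inner_secondForm hO hx (h.immersion j).1 (hframe.smooth k) (hframe.normal k)
    (EuclideanSpace.single i 1) (EuclideanSpace.single l 1)
  rw [h.second_form j x hx, sum_inner] at hII
  have hsum : ∀ a, ⟪∑ b, (B x j a * G x b a * ((EuclideanSpace.single i (1 : ℝ) : Dom n) a *
      (EuclideanSpace.single l (1 : ℝ) : Dom n) a)) • e b x, e k x⟫_ℝ =
      B x j a * G x k a * ((EuclideanSpace.single i (1 : ℝ) : Dom n) a *
      (EuclideanSpace.single l (1 : ℝ) : Dom n) a) := fun a => by
    simpa using (hframe.orthonormal x hx).inner_left_fintype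
      (fun b => B x j a * G x b a * ((EuclideanSpace.single i (1 : ℝ) : Dom n) a *
      (EuclideanSpace.single l (1 : ℝ) : Dom n) a)) k
  simp only [hsum] at hII
  rw [hu, inner_sub_right, real_inner_smul_right, h.inner_vecPd hx]
  change _ = ⟪vecPd l (X j) x, vecPd i (e k) x⟫_ℝ at hII
  rw [← hII, Finset.sum_eq_single i]
  · have := h.ne_zero hx j i
    by_cases hli : l = i
    · subst hli
      simp
      field_simp
      ring
    · simp [hli, Ne.symm hli]
  · intro a _ hai
    simp [hai]
  · simp

/-- The coefficients of a tuple of type `O(n)` solve the `G_{m,n}`-system II. -/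
theorem IsTupleTypeOWith.isSolutionII (h : IsTupleTypeOWith O X e B G) (hO : IsOpen O)
    (hr : 0 < r) (hG : ∀ x ∈ O, ∀ k i, G x k i ≠ 0) (l : Fin n) :
    IsSolutionII O (rowF B l) G B := by
  set k₀ : Fin r := ⟨0, hr⟩
  -- Built from one normal field, E_i involves no j; yet it equals ∂_i X_j / b_{ji} for every j, so
  -- it is a frame common to all X_j.
  set E : Fin n → Dom n → Amb n r := fun i y => (G y k₀ i)⁻¹ • vecPd i (e k₀) y with hE
  have hEX : ∀ y ∈ O, ∀ j i, E i y = (B y j i)⁻¹ • vecPd i (X j) y := fun y hy j i => by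
    rw [hE]
    simp only
    rw [h.vecPd_normal hO hy j k₀ i, smul_smul, div_eq_mul_inv,
      inv_mul_cancel_left₀ (hG y hy k₀ i)]
  have hXE : ∀ j i, ∀ y ∈ O, vecPd i (X j) y = B y j i • E i y := fun j i y hy => by
    rw [hEX y hy j i, smul_inv_smul₀ (h.ne_zero hy j i)]
  refine isSolutionII_of_movingFrame (E := E) (N := e) (X := X) hO (finrank_amb n r)
    (fun i => ?_) (h.frame l).smooth (fun j => (h.immersion j).1) h.smooth_B h.smooth_G
    (fun y hy => ?_) h.orth_B (fun y hy i j => h.ne_zero hy i j) hXE (fun k i y hy => ?_) l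
  · exact ((h.smooth_G k₀ i).inv fun y hy => hG y hy k₀ i).smul
      (contDiffOn_vecPd hO ((h.frame l).smooth k₀) i)
  · refine orthonormal_sum_elim ?_ ((h.frame l).orthonormal y hy) fun i k => ?_
    · rw [orthonormal_iff_ite]
      intro i k
      have hne := h.ne_zero hy l i
      rw [hEX y hy l, hEX y hy l, real_inner_smul_left, real_inner_smul_right,
        h.inner_vecPd hy]
      by_cases hik : i = k
      · subst hik
        simp
        field_simp
      · simp [hik]
    · rw [hEX y hy l, real_inner_smul_left]
      exact mul_eq_zero_of_right _ (inner_fderiv_of_mem_normalPlane ((h.frame l).normal k y hy) _)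
  · rw [h.vecPd_normal hO hy l, hXE l i y hy, smul_smul, div_mul_cancel₀ _ (h.ne_zero hy l i)]

end Tuples

end GSystem

end

theorem theorem6p8 (n r : ℕ) :
    -- from solutions of the system to tuples of type `O(n)`
    (∀ (F : GSystem.Dom n → Matrix (Fin n) (Fin n) ℝ)
      (G : GSystem.Dom n → Matrix (Fin r) (Fin n) ℝ)
      (B : GSystem.Dom n → Matrix (Fin n) (Fin n) ℝ),
      GSystem.IsSolutionII Set.univ F G B →
        (GSystem.IsFlatConnection (GSystem.tau F G) ∧ ∃ A, GSystem.IsFrameII F G A) ∧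
        (∀ A, GSystem.IsFrameII F G A → ∃ X, GSystem.IsPrimitiveII A B X) ∧
        (∀ A X, GSystem.IsFrameII F G A → GSystem.IsPrimitiveII A B X →
          (∀ x i j, B x i j ≠ 0) →
            GSystem.IsTupleTypeO Set.univ (GSystem.column X) ∧
            (∀ j x, GSystem.tangentPlane (GSystem.column X j) x =
              Submodule.span ℝ
                (Set.range fun i : Fin n => GSystem.column A (Sum.inl i) x)) ∧
            (∀ j, GSystem.IsParallelNormalFrame Set.univ (GSystem.column X j)
              fun k : Fin r => GSystem.column A (Sum.inr k)) ∧
            (∀ j x v w, GSystem.firstForm (GSystem.column X j) x v w =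
              ∑ i, B x j i ^ 2 * (v i * w i)) ∧
            (∀ j x v w, GSystem.secondForm (GSystem.column X j) x v w =
              -∑ i, ∑ k, (G x k i * B x j i * (v i * w i)) • GSystem.column A (Sum.inr k) x) ∧
            (∀ j, GSystem.HasNondegenerateNormalBundle Set.univ (GSystem.column X j) ↔
              ∀ x, (G x).rank = n))) ∧
    -- from tuples of type `O(n)` to solutions of the system
    (0 < r → ∀ (O : Set (GSystem.Dom n)) (X : Fin n → GSystem.Dom n → GSystem.Amb n r)
      (e : Fin r → GSystem.Dom n → GSystem.Amb n r)
      (B : GSystem.Dom n → Matrix (Fin n) (Fin n) ℝ)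
      (G : GSystem.Dom n → Matrix (Fin r) (Fin n) ℝ),
      IsOpen O → GSystem.IsTupleTypeOWith O X e B G → (∀ x ∈ O, ∀ k i, G x k i ≠ 0) →
        (∀ x ∈ O, ∀ i j, B x i j ≠ 0) ∧
        ∀ l, GSystem.IsSolutionII O (GSystem.rowF B l) G B) := by
  refine ⟨fun F G B h => ⟨⟨h.isFlatConnection_tau, h.exists_isFrameII⟩,
      fun A hA => hA.exists_isPrimitiveII h, fun A X hA hX hB => ?_⟩,
    fun hr O X e B G hO h hG => ⟨fun x hx i j => h.ne_zero hx i j, h.isSolutionII hO hr hG⟩⟩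
  exact ⟨⟨_, _, _, hX.isTupleTypeOWith hA hB h⟩, hX.tangentPlane_eq hB,
    hX.isParallelNormalFrame hA hB, hX.firstForm_eq hA, hX.secondForm_eq hA hB,
    hX.hasNondegenerateNormalBundle_iff hA hB⟩
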